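/- **Setting.** Let $d\ge1$, let $v:\mathbb R^d\to\mathbb R$ be bounded, measurable and even, $\mathfrak H=L^2(\mathbb R^d)$, and let $\varphi\in\mathfrak H$ with $\|\varphi\|=1$; in the application $\varphi=\varphi(t)$ is the solution at any time $t$ of the Hartree equation $i\partial_t\varphi=(-\Delta+v*|\varphi|^2-\mu^\varphi)\varphi=:h^\varphi\varphi$ with normalized initial datum $\varphi(0)\in H^1(\mathbb R^d)$, where $\mu^\varphi=\tfrac12\int(v*|\varphi|^2)|\varphi|^2$. Let $\mathcal F=\bigoplus_{k\ge0}\bigotimes_{\mathrm{sym}}^k\mathfrak H$ be the bosonic Fock space with creation and annihilation operators $a_x^\dagger,a_x$ and number operator $\mathcal N$; for $N\ge2$ let $\lambda_N=\frac1{N-1}$. Put $p=|\varphi\rangle\langle\varphi|$, $q=1-p$, write $q_j$ for $q$ acting on the $j$-th variable, and let $$W(x,y)=v(x-y)-(v*|\varphi|^2)(x)-(v*|\varphi|^2)(y)+2\mu^\varphi .$$ Let $K^{(1)}=q\tilde K^{(1)}q$, where $\tilde K^{(1)}$ has the kernel $\overline{\varphi(y)}\,v(x-y)\,\varphi(x)$;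 $K^{(2)}=q_1q_2\big(v(x_1-x_2)\varphi(x_1)\varphi(x_2)\big)\in\mathfrak H\otimes\mathfrak H$; $(K^{(3)}\psi)(x_1,x_2)=q_1q_2W(x_1,x_2)\varphi(x_1)(q\psi)(x_2)$; $K^{(4)}=q_1q_2Wq_1q_2$; and on $\mathcal F$ $$\mathbb K^{(0)}=\int a_x^\dagger h^\varphi_xa_x\,dx,\quad \mathbb K^{(1)}=\int K^{(1)}(x_1;x_2)a^\dagger_{x_1}a_{x_2},\quad \mathbb K^{(2)}=\tfrac12\int K^{(2)}(x_1,x_2)a^\dagger_{x_1}a^\dagger_{x_2},$$ $$\mathbb K^{(3)}=\int K^{(3)}(x_1,x_2;x_3)a^\dagger_{x_1}a^\dagger_{x_2}a_{x_3},\quad \mathbb K^{(4)}=\tfrac12\int K^{(4)}(x_1,x_2;x_3,x_4)a^\dagger_{x_1}a^\dagger_{x_2}a_{x_3}a_{x_4},$$ with $\overline{\mathbb K^{(j)}}=(\mathbb K^{(j)})^*$ for $j=2,3$. The excitation Hamiltonian is $$\mathbb H_\varphi=\mathbb K^{(0)}+\tfrac{N-\mathcal N}{N-1}\mathbb K^{(1)}+\Big(\mathbb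 K^{(2)}\tfrac{\sqrt{[(N-\mathcal N)(N-\mathcal N-1)]_+}}{N-1}+\tfrac{\sqrt{[(N-\mathcal N)(N-\mathcal N-1)]_+}}{N-1}\overline{\mathbb K^{(2)}}\Big)+\Big(\mathbb K^{(3)}\tfrac{\sqrt{[N-\mathcal N]_+}}{N-1}+\tfrac{\sqrt{[N-\mathcal N]_+}}{N-1}\overline{\mathbb K^{(3)}}\Big)+\tfrac1{N-1}\mathbb K^{(4)} .$$ With $c^{(\ell)}_0=1$, $c^{(\ell)}_n=\frac{(\ell-\frac12)(\ell+\frac12)\cdots(\ell+n-\frac32)}{n!}$ for $n\ge1$, $c_n=c^{(0)}_n$, and $d_{n,\nu}=\sum_{\ell=0}^\nu c^{(0)}_\ell c^{(0)}_{\nu-\ell}c^{(\ell)}_{n-\nu}$ for $0\le\nu\le n$, define the $N$-independent operators $$\mathbb H^{(0)}=\mathbb K^{(0)}+\mathbb K^{(1)}+\mathbb K^{(2)}+\overline{\mathbb K^{(2)}},\qquad \mathbb H^{(1)}=\mathbb K^{(3)}+\overline{\mathbb K^{(3)}},$$ $$\mathbb H^{(2)}=-(\mathcal N-1)\mathbb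 K^{(1)}-\mathbb K^{(2)}(\mathcal N-\tfrac12)-(\mathcal N-\tfrac12)\overline{\mathbb K^{(2)}}+\mathbb K^{(4)},$$ and for $n\ge2$ $$\mathbb H^{(2n-1)}=c_{n-1}\Big(\mathbb K^{(3)}(\mathcal N-1)^{n-1}+(\mathcal N-1)^{n-1}\overline{\mathbb K^{(3)}}\Big),\qquad \mathbb H^{(2n)}=\sum_{\nu=0}^nd_{n,\nu}\Big(\mathbb K^{(2)}(\mathcal N-1)^\nu+(\mathcal N-1)^\nu\overline{\mathbb K^{(2)}}\Big).$$ Here $\mathbb K^{(0)}$ carries its natural domain, and every other operator given by an algebraic expression in the $\mathbb K^{(j)}$ ($j\ge1$), $\overline{\mathbb K^{(j)}}$ and $\mathcal N$ acts component by component in the particle number, on its maximal domain in $\mathcal F$. **Lemma.** Let $a\in\mathbb N_0$. There is a constant $C(a)>0$, depending only on $a$ and the fixed data $d,v$ (not on $N$ or $\varphi$), such that for all $\varphi$ as above and all $N\ge2$ there is an operator $\mathcal R^{(a)}$ in $\mathcal F$ with $$\mathbb H_\varphi=\sum_{n=0}^a\lambda_N^{n/2}\,\mathbb H^{(n)}+\lambda_N^{(a+1)/2}\,\mathcal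 R^{(a)}$$ on the intersection of the domains of all the summands on the right. This intersection contains $\mathcal D(\mathbb K^{(0)})\cap\mathcal D((\mathcal N+1)^{(a+4)/2})$. Moreover every $\phi\in\mathcal D((\mathcal N+1)^{(a+4)/2})$ lies in the domain of $\mathcal R^{(a)}$, and $$\|\mathcal R^{(a)}\phi\|_{\mathcal F}\le C(a)\,\big\|(\mathcal N+1)^{\frac{a+4}2}\phi\big\|_{\mathcal F}.$$ -/

import Mathlib

open MeasureTheory Filter

open scoped ENNReal ContDiff

noncomputable section

namespace BoseGas

/-! ## One-particle space, `k`-particle spaces, Fock space -/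

/-- The position space `ℝ^d` of one particle. -/
abbrev Pos (d : ℕ) : Type := EuclideanSpace ℝ (Fin d)

/-- The one-particle space `𝔥 = L²(ℝ^d; ℂ)`. -/
abbrev OneBody (d : ℕ) : Type := Lp ℂ 2 (volume : Measure (Pos d))

/-- The (not symmetrized) `k`-particle space `𝔥^k = L²((ℝ^d)^k; ℂ)`. -/
abbrev L2 (d k : ℕ) : Type := Lp ℂ 2 (volume : Measure (Fin k → Pos d))

theorem measurePreserving_comp_perm (d k : ℕ) (σ : Equiv.Perm (Fin k)) :
    MeasurePreserving (fun x : Fin k → Pos d => fun i => x (σ i)) volume volume := by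
  have h := volume_measurePreserving_piCongrLeft (fun _ : Fin k => Pos d) σ⁻¹
  convert h using 1
  ext x i : 2
  conv_rhs => rw [show i = σ⁻¹ (σ i) by simp]
  exact (Equiv.piCongrLeft_apply_apply (fun _ : Fin k => Pos d) σ⁻¹ x (σ i)).symm

/-- Relabelling of the particles: `(relabel σ ψ)(x₁,…,x_k) = ψ(x_{σ 1},…,x_{σ k})`. -/
def relabel (d k : ℕ) (σ : Equiv.Perm (Fin k)) : L2 d k →ₗᵢ[ℂ] L2 d k :=
  Lp.compMeasurePreservingₗᵢ ℂ (fun x : Fin k → Pos d => fun i => x (σ i))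
    (measurePreserving_comp_perm d k σ)

/-- The bosonic `k`-particle space: the functions in `L²((ℝ^d)^k)` that are invariant under all
permutations of the particles. -/
def symSubspace (d k : ℕ) : Submodule ℂ (L2 d k) where
  carrier := {ψ | ∀ σ : Equiv.Perm (Fin k), relabel d k σ ψ = ψ}
  add_mem' := by
    intro a b ha hb σ
    rw [map_add, ha σ, hb σ]
  zero_mem' := fun σ => map_zero _
  smul_mem' := by
    intro c a ha σ
    rw [map_smul, ha σ]

theorem isClosed_symSubspace (d k : ℕ) : IsClosed (symSubspace d k : Set (L2 d k)) := by
  have h : (symSubspace d k : Set (L2 d k)) =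
      ⋂ σ : Equiv.Perm (Fin k), {ψ | relabel d k σ ψ = ψ} := by
    ext ψ
    simp [symSubspace]
  rw [h]
  exact isClosed_iInter fun σ => isClosed_eq (relabel d k σ).continuous continuous_id

instance (d k : ℕ) : CompleteSpace (symSubspace d k) :=
  (isClosed_symSubspace d k).completeSpace_coe

/-- All sequences `(ϕ^(k))_k` with `ϕ^(k)` in the bosonic `k`-particle space, without any
summability. -/
abbrev SeqSpace (d : ℕ) : Type := ∀ k : ℕ, symSubspace d k

/-- The bosonic Fock space `ℱ = ⨁_k ⨂_sym^k L²(ℝ^d)`: the Hilbert space of the square summable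
sequences, `‖ϕ‖² = ∑_k ‖ϕ^(k)‖²`. -/
abbrev Fock (d : ℕ) : Type := lp (fun k : ℕ => symSubspace d k) 2

/-! ## Operators on Fock space given sector by sector -/

/-- Operators that act on sequences of `k`-particle functions. -/
abbrev SeqOp (d : ℕ) : Type := Module.End ℂ (SeqSpace d)

/-- The operator on the Fock space that a `SeqOp` induces, on its maximal domain: all `ϕ ∈ ℱ` for
which `A ϕ` is again square summable. -/
def SeqOp.toFock {d : ℕ} (A : SeqOp d) : Fock d →ₗ.[ℂ] Fock d where
  domain :=
    { carrier := {ϕ | Memℓp (A (fun k => ϕ k)) 2}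
      add_mem' := by
        intro a b ha hb
        have h : A (fun k => (a + b) k) = A (fun k => a k) + A (fun k => b k) := by
          rw [← map_add]
          rfl
        change Memℓp (A (fun k => (a + b) k)) 2
        rw [h]
        exact Memℓp.add ha hb
      zero_mem' := by
        have h : A (fun k => (0 : Fock d) k) = 0 := map_zero A
        change Memℓp (A (fun k => (0 : Fock d) k)) 2
        rw [h]
        exact zero_memℓp
      smul_mem' := by
        intro c a ha
        have h : A (fun k => (c • a) k) = c • A (fun k => a k) := by
          rw [← map_smul]
          rfl
        change Memℓp (A (fun k => (c • a) k)) 2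
        rw [h]
        exact Memℓp.const_smul ha c }
  toFun :=
    { toFun := fun ϕ => ⟨A (fun k => ϕ.1 k), ϕ.2⟩
      map_add' := by
        intro a b
        refine Subtype.ext ?_
        exact map_add A (fun k => a.1 k) (fun k => b.1 k)
      map_smul' := by
        intro c a
        refine Subtype.ext ?_
        exact map_smul A c (fun k => a.1 k) }

theorem SeqOp.mem_toFock_domain {d : ℕ} (A : SeqOp d) (ϕ : Fock d) :
    ϕ ∈ A.toFock.domain ↔ Memℓp (A (fun k => ϕ k)) 2 :=
  Iff.rfl

theorem SeqOp.toFock_apply {d : ℕ} (A : SeqOp d) (ϕ : A.toFock.domain) (k : ℕ) :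
    (A.toFock ϕ) k = A (fun j => ϕ.1 j) k :=
  rfl

/-- The function `g(𝒩)` of the number operator: `(g(𝒩) ϕ)^(k) = g(k) ϕ^(k)`. -/
def numFun (d : ℕ) (g : ℕ → ℝ) : SeqOp d where
  toFun ϕ := fun k => ((g k : ℝ) : ℂ) • ϕ k
  map_add' a b := by
    funext k
    exact smul_add _ _ _
  map_smul' c a := by
    funext k
    exact smul_comm ((g k : ℝ) : ℂ) c (a k)

/-- The number operator `𝒩`, `(𝒩 ϕ)^(k) = k ϕ^(k)`. -/
def num (d : ℕ) : SeqOp d := numFun d (fun k => (k : ℝ))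

/-- The operator that annihilates `p` and creates `n` particles and whose components are the given
bounded operators `T m` from the `(m + p)`-particle to the `(m + n)`-particle space:
`(shift n p T ϕ)^(m+n) = T m ϕ^(m+p)`, and `(shift n p T ϕ)^(k) = 0` for `k < n`. -/
def shift {d : ℕ} (n p : ℕ) (T : ∀ m, symSubspace d (m + p) →L[ℂ] symSubspace d (m + n)) :
    SeqOp d where
  toFun ϕ := fun k =>
    if h : n ≤ k then (Nat.sub_add_cancel h) ▸ T (k - n) (ϕ (k - n + p)) else 0
  map_add' a b := by
    funext k
    have key : ∀ (i j : ℕ) (e : i = j) (u w : symSubspace d i),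
        (e ▸ (u + w) : symSubspace d j) = (e ▸ u : symSubspace d j) + (e ▸ w : symSubspace d j) := by
      intro i j e u w
      subst e
      rfl
    by_cases h : n ≤ k
    · simp only [h, dite_true, Pi.add_apply, map_add]
      exact key _ _ _ _ _
    · simp [h]
  map_smul' c a := by
    funext k
    have key : ∀ (i j : ℕ) (e : i = j) (u : symSubspace d i),
        (e ▸ (c • u) : symSubspace d j) = c • (e ▸ u : symSubspace d j) := by
      intro i j e u
      subst e
      rfl
    by_cases h : n ≤ k
    · simp only [h, dite_true, Pi.smul_apply, map_smul, RingHom.id_apply]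
      exact key _ _ _ _
    · simp [h]

theorem shift_apply_add {d : ℕ} (n p : ℕ)
    (T : ∀ m, symSubspace d (m + p) →L[ℂ] symSubspace d (m + n)) (ϕ : SeqSpace d) (m : ℕ) :
    shift n p T ϕ (m + n) = T m (ϕ (m + p)) := by
  have key : ∀ (j : ℕ) (hj : j = m) (e : j + n = m + n),
      (e ▸ T j (ϕ (j + p)) : symSubspace d (m + n)) = T m (ϕ (m + p)) := by
    intro j hj e
    subst hj
    rfl
  have h : n ≤ m + n := Nat.le_add_left n m
  change (if h : n ≤ m + n then (Nat.sub_add_cancel h) ▸ T (m + n - n) (ϕ (m + n - n + p))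
    else 0 : symSubspace d (m + n)) = _
  rw [dif_pos h]
  exact key (m + n - n) (Nat.add_sub_cancel m n) _

theorem shift_apply_of_lt {d : ℕ} (n p : ℕ)
    (T : ∀ m, symSubspace d (m + p) →L[ℂ] symSubspace d (m + n)) (ϕ : SeqSpace d) {k : ℕ}
    (hk : k < n) : shift n p T ϕ k = 0 := by
  change (if h : n ≤ k then (Nat.sub_add_cancel h) ▸ T (k - n) (ϕ (k - n + p))
    else 0 : symSubspace d k) = _
  rw [dif_neg (by omega)]

/-! ## Elementary operations on `k`-particle functions -/

theorem memLp_tensor {d k : ℕ} (f : OneBody d) (ψ : L2 d k) :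
    MemLp (fun x : Fin (k + 1) → Pos d => f (x 0) * ψ (fun i => x i.succ)) 2 volume ∧
      eLpNorm (fun x : Fin (k + 1) → Pos d => f (x 0) * ψ (fun i => x i.succ)) 2 volume =
        eLpNorm f 2 volume * eLpNorm ψ 2 volume := by
  have hmp := volume_preserving_piFinSuccAbove (fun _ : Fin (k + 1) => Pos d) 0
  have hF : (fun x : Fin (k + 1) → Pos d => f (x 0) * ψ (fun i => x i.succ)) =
      (fun z : Pos d × (Fin k → Pos d) => f z.1 * ψ z.2) ∘
        (MeasurableEquiv.piFinSuccAbove (fun _ : Fin (k + 1) => Pos d) 0) := by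
    funext x
    rfl
  have hm : AEStronglyMeasurable (fun z : Pos d × (Fin k → Pos d) => f z.1 * ψ z.2)
      (volume : Measure (Pos d × (Fin k → Pos d))) :=
    (Lp.aestronglyMeasurable f).comp_fst.mul (Lp.aestronglyMeasurable ψ).comp_snd
  have hn : eLpNorm (fun z : Pos d × (Fin k → Pos d) => f z.1 * ψ z.2) 2 volume =
      eLpNorm f 2 volume * eLpNorm ψ 2 volume := by
    have h2 : (2 : ℝ≥0∞) ≠ 0 := by norm_num
    have h2' : (2 : ℝ≥0∞) ≠ ⊤ := by norm_num
    rw [eLpNorm_eq_lintegral_rpow_enorm_toReal h2 h2', eLpNorm_eq_lintegral_rpow_enorm_toReal h2 h2',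
      eLpNorm_eq_lintegral_rpow_enorm_toReal h2 h2', ← ENNReal.mul_rpow_of_nonneg _ _ (by positivity)]
    congr 1
    rw [Measure.volume_eq_prod, ← lintegral_prod_mul
      ((Lp.aestronglyMeasurable f).enorm.pow_const _) ((Lp.aestronglyMeasurable ψ).enorm.pow_const _)]
    congr 1
    funext z
    rw [enorm_mul, ENNReal.mul_rpow_of_nonneg _ _ (by positivity)]
  have hn' : eLpNorm (fun x : Fin (k + 1) → Pos d => f (x 0) * ψ (fun i => x i.succ)) 2 volume =
      eLpNorm f 2 volume * eLpNorm ψ 2 volume := by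
    rw [hF, eLpNorm_comp_measurePreserving hm hmp, hn]
  refine ⟨⟨?_, ?_⟩, hn'⟩
  · rw [hF]
    exact hm.comp_measurePreserving hmp
  · rw [hn']
    exact ENNReal.mul_lt_top (Lp.memLp f).2 (Lp.memLp ψ).2

/-- The map `ψ ↦ f ⊗ ψ`, `(f ⊗ ψ)(x₁,…,x_{k+1}) = f(x₁) ψ(x₂,…,x_{k+1})`. -/
def tensor (d k : ℕ) (f : OneBody d) : L2 d k →L[ℂ] L2 d (k + 1) :=
  LinearMap.mkContinuous
    { toFun := fun ψ => (memLp_tensor f ψ).1.toLp _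
      map_add' := by
        intro a b
        rw [← MemLp.toLp_add, MemLp.toLp_eq_toLp_iff]
        have hq : Measure.QuasiMeasurePreserving
            (fun x : Fin (k + 1) → Pos d => fun i : Fin k => x i.succ) volume volume :=
          (Measure.quasiMeasurePreserving_snd.comp
            (volume_preserving_piFinSuccAbove
              (fun _ : Fin (k + 1) => Pos d) 0).quasiMeasurePreserving :)
        filter_upwards [hq.ae (Lp.coeFn_add a b)] with x hx
        simp only [Pi.add_apply] at hx ⊢
        rw [hx, mul_add]
      map_smul' := by
        intro c a
        rw [RingHom.id_apply, ← MemLp.toLp_const_smul, MemLp.toLp_eq_toLp_iff]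
        have hq : Measure.QuasiMeasurePreserving
            (fun x : Fin (k + 1) → Pos d => fun i : Fin k => x i.succ) volume volume :=
          (Measure.quasiMeasurePreserving_snd.comp
            (volume_preserving_piFinSuccAbove
              (fun _ : Fin (k + 1) => Pos d) 0).quasiMeasurePreserving :)
        filter_upwards [hq.ae (Lp.coeFn_smul c a)] with x hx
        simp only [Pi.smul_apply, smul_eq_mul] at hx ⊢
        rw [hx]
        ring }
    ‖f‖ (by
      intro ψ
      change ‖(memLp_tensor f ψ).1.toLp _‖ ≤ _
      rw [Lp.norm_toLp, (memLp_tensor f ψ).2, ENNReal.toReal_mul, Lp.norm_def, Lp.norm_def])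

theorem coeFn_tensor {d k : ℕ} (f : OneBody d) (ψ : L2 d k) :
    tensor d k f ψ =ᵐ[volume] fun x => f (x 0) * ψ (fun i => x i.succ) :=
  MemLp.coeFn_toLp (memLp_tensor f ψ).1

open Classical in
/-- Multiplication by the (essentially bounded, measurable) real function `w` of the positions of
`k` particles. -/
def mulOp (d k : ℕ) (w : (Fin k → Pos d) → ℝ) : L2 d k →L[ℂ] L2 d k :=
  if h : MemLp (fun x => (w x : ℂ)) (⊤ : ℝ≥0∞) (volume : Measure (Fin k → Pos d)) then
    (ContinuousLinearMap.mul ℂ ℂ).holderL volume ⊤ 2 2 (h.toLp _)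
  else 0

theorem coeFn_mulOp {d k : ℕ} {w : (Fin k → Pos d) → ℝ}
    (h : MemLp (fun x => (w x : ℂ)) (⊤ : ℝ≥0∞) (volume : Measure (Fin k → Pos d))) (ψ : L2 d k) :
    mulOp d k w ψ =ᵐ[volume] fun x => (w x : ℂ) * ψ x := by
  rw [mulOp, dif_pos h]
  have h1 := (ContinuousLinearMap.mul ℂ ℂ).coeFn_holder (r := 2) (h.toLp _) ψ
  filter_upwards [h1, h.coeFn_toLp] with x hx hw
  change ((ContinuousLinearMap.mul ℂ ℂ).holder 2 (h.toLp _) ψ : L2 d k) x = _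
  rw [hx, hw]
  rfl

/-- The transposition of the first two of `m + 2` particles. -/
def swap01 (d m : ℕ) : L2 d (m + 2) →L[ℂ] L2 d (m + 2) :=
  (relabel d (m + 2) (Equiv.swap 0 1)).toContinuousLinearMap

/-- `q₁`: the projection `q = 1 - |φ⟩⟨φ|` acting on the first of `m + 1` particles. Here
`tensor φ` is `ψ ↦ φ ⊗ ψ`, and its adjoint is `ψ ↦ ∫ conj(φ(y)) ψ(y, ·) dy`. -/
def q1 (d m : ℕ) (φ : OneBody d) : L2 d (m + 1) →L[ℂ] L2 d (m + 1) :=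
  ContinuousLinearMap.id ℂ _ -
    (tensor d m φ).comp (ContinuousLinearMap.adjoint (tensor d m φ))

/-- `q₂`: the projection `q` acting on the second of `m + 2` particles. -/
def q2 (d m : ℕ) (φ : OneBody d) : L2 d (m + 2) →L[ℂ] L2 d (m + 2) :=
  (swap01 d m).comp ((q1 d (m + 1) φ).comp (swap01 d m))

/-! ## Mean field quantities -/

/-- `(v * |φ|²)(x)`. -/
def meanField {d : ℕ} (v : Pos d → ℝ) (φ : OneBody d) (x : Pos d) : ℝ :=
  ∫ y, v (x - y) * ‖φ y‖ ^ 2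

/-- `μ^φ = ½ ∫ (v * |φ|²)(x) |φ(x)|² dx`. -/
def chemPot {d : ℕ} (v : Pos d → ℝ) (φ : OneBody d) : ℝ :=
  (1 / 2) * ∫ x, meanField v φ x * ‖φ x‖ ^ 2

/-- `W_φ(x, y) = v(x - y) - (v * |φ|²)(x) - (v * |φ|²)(y) + 2 μ^φ`. -/
def potW {d : ℕ} (v : Pos d → ℝ) (φ : OneBody d) (x y : Pos d) : ℝ :=
  v (x - y) - meanField v φ x - meanField v φ y + 2 * chemPot v φ

/-! ## The kernels `K^(1), …, K^(4)`

Each of them is given in the form `K^(j) ⊗ 1`, acting on the first particles in the presence of `m`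
further particles. For `m = 0` one obtains the operators
`K^(1) : 𝔥 → 𝔥`, `K^(3) : 𝔥 → 𝔥²`, `K^(4) : 𝔥² → 𝔥²` and the function `K^(2) ∈ 𝔥²`. -/

/-- The operator with kernel `K̃^(1)(x; y) = conj(φ(y)) v(x - y) φ(x)` on the first particle,
`(K̃^(1)ψ)(x, z) = ∫ conj(φ(y)) v(y - x) φ(x) ψ(y, z) dy`: from the right to the left, the
factors produce `φ(y) ψ(x, z)`, `φ(x) ψ(y, z)`, `v(y - x) φ(x) ψ(y, z)`, and integrate this
against `conj(φ(y))`. -/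
def kernelK1tilde (d : ℕ) (v : Pos d → ℝ) (φ : OneBody d) (m : ℕ) :
    L2 d (m + 1) →L[ℂ] L2 d (m + 1) :=
  (ContinuousLinearMap.adjoint (tensor d (m + 1) φ)).comp
    ((mulOp d (m + 2) (fun x => v (x 0 - x 1))).comp
      ((swap01 d m).comp (tensor d (m + 1) φ)))

/-- `K^(1) = q K̃^(1) q`. -/
def kernelK1 (d : ℕ) (v : Pos d → ℝ) (φ : OneBody d) (m : ℕ) :
    L2 d (m + 1) →L[ℂ] L2 d (m + 1) :=
  (q1 d m φ).comp ((kernelK1tilde d v φ m).comp (q1 d m φ))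

/-- Tensor product with the function `K^(2) = q₁ q₂ K̃^(2)`,
`K̃^(2)(x₁, x₂) = v(x₁ - x₂) φ(x₁) φ(x₂)`. -/
def kernelK2 (d : ℕ) (v : Pos d → ℝ) (φ : OneBody d) (m : ℕ) :
    L2 d m →L[ℂ] L2 d (m + 2) :=
  (q1 d (m + 1) φ).comp ((q2 d m φ).comp
    ((mulOp d (m + 2) (fun x => v (x 0 - x 1))).comp
      ((tensor d (m + 1) φ).comp (tensor d m φ))))

/-- `(K^(3) ψ)(x₁, x₂) = q₁ q₂ W(x₁, x₂) φ(x₁) (q ψ)(x₂)`. -/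
def kernelK3 (d : ℕ) (v : Pos d → ℝ) (φ : OneBody d) (m : ℕ) :
    L2 d (m + 1) →L[ℂ] L2 d (m + 2) :=
  (q1 d (m + 1) φ).comp ((q2 d m φ).comp
    ((mulOp d (m + 2) (fun x => potW v φ (x 0) (x 1))).comp
      ((tensor d (m + 1) φ).comp (q1 d m φ))))

/-- `(K^(4) ψ)(x₁, x₂) = q₁ q₂ W(x₁, x₂) (q₁ q₂ ψ)(x₁, x₂)`. -/
def kernelK4 (d : ℕ) (v : Pos d → ℝ) (φ : OneBody d) (m : ℕ) :
    L2 d (m + 2) →L[ℂ] L2 d (m + 2) :=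
  (q1 d (m + 1) φ).comp ((q2 d m φ).comp
    ((mulOp d (m + 2) (fun x => potW v φ (x 0) (x 1))).comp
      ((q1 d (m + 1) φ).comp (q2 d m φ))))

/-! ## Second quantization -/

/-- The components, from the `(m + p)`-particle to the `(m + n)`-particle space, of
`∫ T(x₁,…,x_n; y₁,…,y_p) a†_{x₁} ⋯ a†_{x_n} a_{y₁} ⋯ a_{y_p} dx dy`,
where `T m` stands for `T ⊗ 1^{⊗ m}`. By the definition of `a†` and `a`, this component is
`√((m+p)!/(m+n)!)` times the sum of `T` over all ordered choices of `n` different particles (out of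
`m + n`) as output particles; there are `(m+n)!/m!` choices, so the sum is `(m+n)!/m!` times the
symmetrization, i.e. the orthogonal projection onto the symmetric functions, of `T m ϕ^(m+p)`. -/
def secondQuantComponent {d : ℕ} (n p : ℕ) (T : ∀ m, L2 d (m + p) →L[ℂ] L2 d (m + n)) (m : ℕ) :
    symSubspace d (m + p) →L[ℂ] symSubspace d (m + n) :=
  (((Real.sqrt (((m + p).factorial : ℝ) * ((m + n).factorial : ℝ)) / (m.factorial : ℝ) : ℝ)) : ℂ) •
    ((symSubspace d (m + n)).orthogonalProjectionOnto.comp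
      ((T m).comp (symSubspace d (m + p)).subtypeL))

/-- `∫ T(x₁,…,x_n; y₁,…,y_p) a†_{x₁} ⋯ a†_{x_n} a_{y₁} ⋯ a_{y_p} dx dy`. -/
def secondQuant {d : ℕ} (n p : ℕ) (T : ∀ m, L2 d (m + p) →L[ℂ] L2 d (m + n)) : SeqOp d :=
  shift n p (secondQuantComponent n p T)

/-- The adjoint of `secondQuant n p T`, formed component by component: its component from
the `(m + n)`-particle to the `(m + p)`-particle space is the adjoint of the bounded operator
`secondQuantComponent n p T m`. As each component of `secondQuant n p T ϕ` involves only one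
component of `ϕ`, this is, on its maximal domain, the Hilbert space adjoint of `secondQuant n p T`. -/
def secondQuantAdjoint {d : ℕ} (n p : ℕ) (T : ∀ m, L2 d (m + p) →L[ℂ] L2 d (m + n)) : SeqOp d :=
  shift p n (fun m => ContinuousLinearMap.adjoint (secondQuantComponent n p T m))

variable {d : ℕ}

/-- `𝕂^(1) = ∫ K^(1)(x₁; x₂) a†_{x₁} a_{x₂}`. -/
def opK1 (v : Pos d → ℝ) (φ : OneBody d) : SeqOp d :=
  secondQuant 1 1 (kernelK1 d v φ)

/-- `𝕂^(2) = ½ ∫ K^(2)(x₁, x₂) a†_{x₁} a†_{x₂}`. -/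
def opK2 (v : Pos d → ℝ) (φ : OneBody d) : SeqOp d :=
  (1 / 2 : ℂ) • secondQuant 2 0 (kernelK2 d v φ)

/-- The adjoint of `𝕂^(2)`. -/
def opK2bar (v : Pos d → ℝ) (φ : OneBody d) : SeqOp d :=
  (1 / 2 : ℂ) • secondQuantAdjoint 2 0 (kernelK2 d v φ)

/-- `𝕂^(3) = ∫ K^(3)(x₁, x₂; x₃) a†_{x₁} a†_{x₂} a_{x₃}`. -/
def opK3 (v : Pos d → ℝ) (φ : OneBody d) : SeqOp d :=
  secondQuant 2 1 (kernelK3 d v φ)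

/-- The adjoint of `𝕂^(3)`. -/
def opK3bar (v : Pos d → ℝ) (φ : OneBody d) : SeqOp d :=
  secondQuantAdjoint 2 1 (kernelK3 d v φ)

/-- `𝕂^(4) = ½ ∫ K^(4)(x₁, x₂; x₃, x₄) a†_{x₁} a†_{x₂} a_{x₃} a_{x₄}`. -/
def opK4 (v : Pos d → ℝ) (φ : OneBody d) : SeqOp d :=
  (1 / 2 : ℂ) • secondQuant 2 2 (kernelK4 d v φ)

/-! ## The one-body operator `𝕂^(0) = dΓ(h)` -/

/-- The Laplacian `∑_j Δ_{x_j}` of a function of `k` particle positions. -/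
def lap {k : ℕ} (θ : (Fin k → Pos d) → ℝ) (x : Fin k → Pos d) : ℝ :=
  ∑ j : Fin k, ∑ i : Fin d,
    iteratedFDeriv ℝ 2 θ x (fun _ => Pi.single j (EuclideanSpace.single i (1 : ℝ)))

/-- `g = Δψ` in the sense of distributions. -/
def IsWeakLap {k : ℕ} (ψ g : L2 d k) : Prop :=
  ∀ θ : (Fin k → Pos d) → ℝ, ContDiff ℝ ∞ θ → HasCompactSupport θ →
    ∫ x, (θ x : ℂ) * g x = ∫ x, (lap θ x : ℂ) * ψ x

/-- The potential part `∑_j ((v * |φ|²)(x_j) - μ^φ)` of `h^φ = -Δ + v * |φ|² - μ^φ`. -/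
def hartreePot (v : Pos d → ℝ) (φ : OneBody d) (k : ℕ) (x : Fin k → Pos d) : ℝ :=
  ∑ j : Fin k, (meanField v φ (x j) - chemPot v φ)

theorem continuous_lap {k : ℕ} {θ : (Fin k → Pos d) → ℝ} (hθ : ContDiff ℝ ∞ θ) :
    Continuous (lap θ) := by
  unfold lap
  refine continuous_finsetSum _ fun j _ => continuous_finsetSum _ fun i _ => ?_
  have h := hθ.continuous_iteratedFDeriv (m := 2) (WithTop.coe_le_coe.2 le_top)
  fun_prop

theorem hasCompactSupport_lap {k : ℕ} {θ : (Fin k → Pos d) → ℝ} (hc : HasCompactSupport θ) :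
    HasCompactSupport (lap θ) := by
  refine (hc.iteratedFDeriv (𝕜 := ℝ) 2).mono ?_
  intro x hx
  rw [Function.mem_support] at hx ⊢
  intro h0
  apply hx
  simp [lap, h0]

theorem integrable_test_mul {k : ℕ} {θ : (Fin k → Pos d) → ℝ} (hθ : Continuous θ)
    (hc : HasCompactSupport θ) (ψ : L2 d k) : Integrable (fun x => (θ x : ℂ) * ψ x) volume := by
  have h1 : MemLp (fun x => (θ x : ℂ)) 2 (volume : Measure (Fin k → Pos d)) :=
    (hθ.memLp_of_hasCompactSupport hc).ofReal
  exact h1.integrable_mul (Lp.memLp ψ)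

theorem integral_mul_zero {k : ℕ} (θ : (Fin k → Pos d) → ℝ) :
    ∫ x, (θ x : ℂ) * (0 : L2 d k) x = 0 := by
  have h : (fun x : Fin k → Pos d => (θ x : ℂ) * (0 : L2 d k) x) =ᵐ[volume] fun _ => 0 := by
    filter_upwards [Lp.coeFn_zero ℂ 2 (volume : Measure (Fin k → Pos d))] with x hx
    rw [hx, Pi.zero_apply, mul_zero]
  rw [integral_congr_ae h, integral_zero]

theorem isWeakLap_zero {k : ℕ} : IsWeakLap (0 : L2 d k) 0 := by
  intro θ _ _
  rw [integral_mul_zero, integral_mul_zero]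

theorem IsWeakLap.add {k : ℕ} {ψ₁ ψ₂ g₁ g₂ : L2 d k} (h₁ : IsWeakLap ψ₁ g₁)
    (h₂ : IsWeakLap ψ₂ g₂) : IsWeakLap (ψ₁ + ψ₂) (g₁ + g₂) := by
  have key : ∀ (θ : (Fin k → Pos d) → ℝ), Continuous θ → HasCompactSupport θ →
      ∀ a b : L2 d k, ∫ x, (θ x : ℂ) * (a + b : L2 d k) x =
        (∫ x, (θ x : ℂ) * a x) + ∫ x, (θ x : ℂ) * b x := by
    intro θ hθ hc a b
    rw [← integral_add (integrable_test_mul hθ hc a) (integrable_test_mul hθ hc b)]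
    refine integral_congr_ae ?_
    filter_upwards [Lp.coeFn_add a b] with x hx
    rw [hx, Pi.add_apply, mul_add]
  intro θ hθ hc
  rw [key θ hθ.continuous hc, key _ (continuous_lap hθ) (hasCompactSupport_lap hc),
    h₁ θ hθ hc, h₂ θ hθ hc]

theorem IsWeakLap.smul {k : ℕ} {ψ g : L2 d k} (c : ℂ) (h : IsWeakLap ψ g) :
    IsWeakLap (c • ψ) (c • g) := by
  have key : ∀ (θ : (Fin k → Pos d) → ℝ) (a : L2 d k),
      ∫ x, (θ x : ℂ) * (c • a : L2 d k) x = c * ∫ x, (θ x : ℂ) * a x := by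
    intro θ a
    rw [← integral_const_mul]
    refine integral_congr_ae ?_
    filter_upwards [Lp.coeFn_smul c a] with x hx
    rw [hx, Pi.smul_apply, smul_eq_mul]
    ring
  intro θ hθ hc
  rw [key, key, h θ hθ hc]

theorem IsWeakLap.eq_zero {k : ℕ} {g : L2 d k} (h : IsWeakLap 0 g) : g = 0 := by
  have h0 : ∀ᵐ x : Fin k → Pos d, g x = 0 := by
    refine ae_eq_zero_of_integral_contDiff_smul_eq_zero
      ((Lp.memLp g).locallyIntegrable (by norm_num)) ?_
    intro θ hθ hc
    have h1 := h θ hθ hc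
    rw [integral_mul_zero] at h1
    simpa only [Complex.real_smul] using h1
  exact (Lp.eq_zero_iff_ae_eq_zero).2 h0

/-- The graph of `𝕂^(0) = ∫ a†_x h^φ_x a_x dx = dΓ(h^φ)`: the pairs `(ϕ, η)` in `ℱ × ℱ` with
`η^(k) = ∑_j (-Δ_{x_j} + (v * |φ|²)(x_j) - μ^φ) ϕ^(k)` for every `k`, with the Laplacian in the sense
of distributions. -/
def graphK0 (v : Pos d → ℝ) (φ : OneBody d) : Submodule ℂ (Fock d × Fock d) where
  carrier := {z | ∀ k, IsWeakLap (z.1 k : L2 d k)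
    (mulOp d k (hartreePot v φ k) (z.1 k : L2 d k) - (z.2 k : L2 d k))}
  add_mem' := by
    intro a b ha hb k
    have h := (ha k).add (hb k)
    have e1 : ((a + b).1 k : L2 d k) = (a.1 k : L2 d k) + (b.1 k : L2 d k) := rfl
    have e2 : ((a + b).2 k : L2 d k) = (a.2 k : L2 d k) + (b.2 k : L2 d k) := rfl
    rw [e1, e2, map_add, add_sub_add_comm]
    exact h
  zero_mem' := by
    intro k
    have e : ((0 : Fock d) k : L2 d k) = 0 := rfl
    have h : IsWeakLap ((0 : Fock d) k : L2 d k)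
        (mulOp d k (hartreePot v φ k) ((0 : Fock d) k : L2 d k) - ((0 : Fock d) k : L2 d k)) := by
      rw [e, map_zero, sub_zero]
      exact isWeakLap_zero
    exact h
  smul_mem' := by
    intro c a ha k
    have h := (ha k).smul c
    have e1 : ((c • a).1 k : L2 d k) = c • (a.1 k : L2 d k) := rfl
    have e2 : ((c • a).2 k : L2 d k) = c • (a.2 k : L2 d k) := rfl
    rw [e1, e2, map_smul, ← smul_sub]
    exact h

theorem graphK0_single_valued (v : Pos d → ℝ) (φ : OneBody d) :
    ∀ z ∈ graphK0 v φ, z.1 = 0 → z.2 = 0 := by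
  intro z hz h0
  refine lp.ext (funext fun k => Subtype.ext ?_)
  have h := hz k
  rw [h0] at h
  have h1 : ((0 : Fock d) k : L2 d k) = 0 := rfl
  rw [h1, map_zero, zero_sub] at h
  exact neg_eq_zero.1 h.eq_zero

/-- `𝕂^(0) = dΓ(h^φ)`, on its natural domain: all `ϕ ∈ ℱ` with `ϕ^(k)` in the domain of
`∑_j h^φ_{x_j}` and with square summable image. -/
def opK0 (v : Pos d → ℝ) (φ : OneBody d) : Fock d →ₗ.[ℂ] Fock d :=
  (graphK0 v φ).toLinearPMap

theorem opK0_graph (v : Pos d → ℝ) (φ : OneBody d) : (opK0 v φ).graph = graphK0 v φ :=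
  Submodule.toLinearPMap_graph_eq _ (graphK0_single_valued v φ)

/-! ## The excitation Hamiltonian and the coefficients of its expansion -/

/-- `λ_N = 1/(N - 1)`. -/
def lam (N : ℕ) : ℝ := 1 / ((N : ℝ) - 1)

/-- `√([(N - 𝒩)(N - 𝒩 - 1)]_+) / (N - 1)`. -/
def sqrtTwo (d N : ℕ) : SeqOp d :=
  numFun d (fun k => Real.sqrt (max (((N : ℝ) - k) * ((N : ℝ) - k - 1)) 0) / ((N : ℝ) - 1))

/-- `√([N - 𝒩]_+) / (N - 1)`. -/
def sqrtOne (d N : ℕ) : SeqOp d :=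
  numFun d (fun k => Real.sqrt (max ((N : ℝ) - k) 0) / ((N : ℝ) - 1))

/-- The excitation Hamiltonian without `𝕂^(0)`. -/
def excitationRest (v : Pos d → ℝ) (φ : OneBody d) (N : ℕ) : SeqOp d :=
  numFun d (fun k => ((N : ℝ) - k) / ((N : ℝ) - 1)) * opK1 v φ
    + (opK2 v φ * sqrtTwo d N + sqrtTwo d N * opK2bar v φ)
    + (opK3 v φ * sqrtOne d N + sqrtOne d N * opK3bar v φ)
    + (1 / ((N : ℂ) - 1)) • opK4 v φ

/-- The excitation Hamiltonian `ℍ_φ` on the Fock space. -/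
def excitationHamiltonian (v : Pos d → ℝ) (φ : OneBody d) (N : ℕ) : Fock d →ₗ.[ℂ] Fock d :=
  opK0 v φ + (excitationRest v φ N).toFock

/-- `c^(l)_n = (l - 1/2)(l + 1/2) ⋯ (l + n - 3/2) / n!`, with `c^(l)_0 = 1`. -/
def coeffC (l n : ℕ) : ℝ :=
  (∏ i ∈ Finset.range n, ((l : ℝ) - 1 / 2 + i)) / (n.factorial : ℝ)

/-- `d_{n,ν} = ∑_{l=0}^ν c^(0)_l c^(0)_{ν-l} c^(l)_{n-ν}` for `ν ≤ n`. -/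
def coeffD (n ν : ℕ) : ℝ :=
  ∑ l ∈ Finset.range (ν + 1), coeffC 0 l * coeffC 0 (ν - l) * coeffC l (n - ν)

/-- The coefficients `ℍ^(n)`, without the term `𝕂^(0)` of `ℍ^(0)`. -/
def coeffRest (v : Pos d → ℝ) (φ : OneBody d) (n : ℕ) : SeqOp d :=
  if n = 0 then opK1 v φ + opK2 v φ + opK2bar v φ
  else if n = 1 then opK3 v φ + opK3bar v φ
  else if n = 2 then
    -((num d - 1) * opK1 v φ) - opK2 v φ * (num d - (1 / 2 : ℂ) • 1)
      - (num d - (1 / 2 : ℂ) • 1) * opK2bar v φ + opK4 v φ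
  else if Even n then
    ∑ ν ∈ Finset.range (n / 2 + 1), (coeffD (n / 2) ν : ℂ) •
      (opK2 v φ * (num d - 1) ^ ν + (num d - 1) ^ ν * opK2bar v φ)
  else
    (coeffC 0 (n / 2) : ℂ) •
      (opK3 v φ * (num d - 1) ^ (n / 2) + (num d - 1) ^ (n / 2) * opK3bar v φ)

/-- The coefficient `ℍ^(n)_φ` of the expansion of the excitation Hamiltonian. -/
def coeffHamiltonian (v : Pos d → ℝ) (φ : OneBody d) (n : ℕ) : Fock d →ₗ.[ℂ] Fock d :=
  if n = 0 then opK0 v φ + (coeffRest v φ 0).toFock else (coeffRest v φ n).toFock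

/-- The right-hand side `∑_{n=0}^a λ_N^{n/2} ℍ^(n) + λ_N^{(a+1)/2} R` of the expansion, on the
intersection of the domains of all summands. -/
def expansion (v : Pos d → ℝ) (φ : OneBody d) (N a : ℕ) (R : Fock d →ₗ.[ℂ] Fock d) :
    Fock d →ₗ.[ℂ] Fock d :=
  (∑ n ∈ Finset.range (a + 1), ((lam N ^ ((n : ℝ) / 2) : ℝ) : ℂ) • coeffHamiltonian v φ n)
    + ((lam N ^ (((a : ℝ) + 1) / 2) : ℝ) : ℂ) • R

/-- `(𝒩 + 1)^s` on its maximal domain. -/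
def numPow (d : ℕ) (s : ℝ) : Fock d →ₗ.[ℂ] Fock d :=
  (numFun d (fun k => ((k : ℝ) + 1) ^ s)).toFock

end BoseGas

end

noncomputable section

namespace BoseGas

/-! ## Taylor expansion of the coefficient functions -/

/-! Apart from `opK0`, the excitation Hamiltonian and all the coefficients of its expansion have one
common shape: `assembled`, a combination of 𝕂^(1), …, 𝕂^(4) with functions of 𝒩 as weights, linear
in these weights (`excitationRest_eq_assembled`, `coeffRest_eq_assembled`). The remainder is
therefore `assembled` on the difference of the weights, divided by λ^((a+1)/2). The operator
identity `sum_add_smul_remainder` is then linearity, and the estimate splits into two independent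
power counts.

Scalar part. With λ = 1/(N-1) and on the sector k, the weights of the Hamiltonian are 1 - λ(k-1),
√[(1-λ(k-1))(1-λk)]_+, √λ √[1-λ(k-1)]_+ and λ. The first and the last are polynomials in λ. For the
roots, the Taylor error after m terms is at most C (λ(k+1))^m (`exists_remainder_two_bound` with m ≥
1, `exists_remainder_one_bound`). If λ(k+1) ≤ 1/4 this is the binomial series. If λ(k+1) ≥ 1/4
nothing is small, but each Taylor term, and the root itself, is bounded by a multiple of (λ(k+1))^m.
Hence the bound holds on all sectors and no cutoff in 𝒩 is needed.

Operator part. Each creation or annihilation operator costs half a power of the particle number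
(`norm_secondQuantComponent_le`), and the kernels are bounded in terms of sup |v| alone because ‖φ‖
= 1. So 𝕂^(1) and 𝕂^(2) cost one power of 𝒩+1, 𝕂^(3) costs 3/2 and 𝕂^(4) costs 2
(`relBdd_assembled`). Adding the powers from the Taylor errors never exceeds (a+4)/2, while the
power of λ is at least (a+1)/2; since λ ≤ 1 the excess can be dropped.

Domains: operators on maximal domains add only up to extension, which is the direction needed in
`expansion_le`; relative bounds for each coefficient give the domain inclusion. -/

theorem multichoose_eq_prod_div (s : ℝ) (n : ℕ) :
    Ring.multichoose s n = (∏ i ∈ Finset.range n, (s + i)) / (n.factorial : ℝ) := by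
  have h := Ring.factorial_nsmul_multichoose_eq_ascPochhammer s n
  rw [Polynomial.ascPochhammer_smeval_eq_eval] at h
  have h2 : ∀ n : ℕ, (ascPochhammer ℝ n).eval s = ∏ i ∈ Finset.range n, (s + i) := by
    intro n
    induction n with
    | zero => simp
    | succ n ih => rw [ascPochhammer_succ_eval, ih, Finset.prod_range_succ]
  rw [h2, nsmul_eq_mul] at h
  have h3 : (n.factorial : ℝ) ≠ 0 := by exact_mod_cast n.factorial_ne_zero
  rw [← h]
  field_simp

/-- The binomial series of (1-x)^(-s) has radius of convergence at least 1. The geometric error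
estimate at the intermediate radius 3/4 gives C (q · 4|x|/3)^m, which covers |x| ≤ 1/2. -/
theorem exists_taylor_bound (s : ℝ) (m : ℕ) :
    ∃ C : ℝ, 0 ≤ C ∧ ∀ x : ℝ, |x| ≤ 1 / 2 →
      |1 / (1 - x) ^ s -
        ∑ j ∈ Finset.range m, (∏ i ∈ Finset.range j, (s + i)) / (j.factorial : ℝ) * x ^ j| ≤
        C * |x| ^ m := by
  obtain ⟨q, hq, C, hC, h⟩ :=
    (Real.one_div_one_sub_rpow_hasFPowerSeriesOnBall_zero s).uniform_geometric_approx'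
      (r' := 3 / 4) (by
        rw [← ENNReal.coe_one, ENNReal.coe_lt_coe, ← NNReal.coe_lt_coe]
        norm_num)
  refine ⟨C * (q * (4 / 3)) ^ m, by have := hq.1; positivity, fun x hx => ?_⟩
  have h1 := h x (by
    rw [Metric.mem_ball, dist_zero_right, Real.norm_eq_abs]
    refine lt_of_le_of_lt hx ?_
    norm_num) m
  simp only [zero_add, Real.norm_eq_abs, FormalMultilinearSeries.partialSum,
    FormalMultilinearSeries.ofScalars_apply_eq, smul_eq_mul, ← Ring.multichoose_eq,
    multichoose_eq_prod_div] at h1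
  refine h1.trans (le_of_eq ?_)
  rw [mul_assoc, ← mul_pow]
  congr 2
  norm_num
  ring

/-- Composition of expansions: if `F ~ ∑ aᵢ gᵢ` and `gᵢ ~ ∑ⱼ bᵢⱼ`, with errors of order `ε^m` after
`m` terms, then `F ~ ∑ₙ ∑_{i+j=n} aᵢ bᵢⱼ`. -/
theorem exists_expansion_bound {P : Type*} (ε F : P → ℝ) (A g : ℕ → P → ℝ) (b : ℕ → ℕ → P → ℝ)
    (m : ℕ)
    (hF : ∃ C, ∀ p, |F p - ∑ i ∈ Finset.range m, A i p * g i p| ≤ C * ε p ^ m)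
    (hA : ∀ i, ∃ C, ∀ p, |A i p| ≤ C * ε p ^ i)
    (hg : ∀ i r, ∃ C, ∀ p, |g i p - ∑ j ∈ Finset.range r, b i j p| ≤ C * ε p ^ r) :
    ∃ C, ∀ p, |F p - ∑ n ∈ Finset.range m, ∑ i ∈ Finset.range (n + 1), A i p * b i (n - i) p| ≤
      C * ε p ^ m := by
  obtain ⟨C, hC⟩ := hF
  choose D hD using hA
  choose G hG using hg
  refine ⟨C + ∑ i ∈ Finset.range m, D i * G i (m - i), fun p => ?_⟩
  -- The factor `A i` already has size ε^i, so its inner expansion is cut at order m - i. The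
  -- retained pairs are those with i + j < m, which are summed along diagonals.
  have e : F p - ∑ n ∈ Finset.range m, ∑ i ∈ Finset.range (n + 1), A i p * b i (n - i) p =
      (F p - ∑ i ∈ Finset.range m, A i p * g i p) +
      ∑ i ∈ Finset.range m, A i p * (g i p - ∑ j ∈ Finset.range (m - i), b i j p) := by
    rw [Finset.sum_range_diag_flip m (fun i j => A i p * b i j p)]
    simp only [mul_sub, Finset.sum_sub_distrib, Finset.mul_sum]
    ring
  rw [e, add_mul, Finset.sum_mul]
  refine (abs_add_le _ _).trans (add_le_add (hC p) ((Finset.abs_sum_le_sum_abs _ _).trans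
    (Finset.sum_le_sum fun i hi => ?_)))
  have him : i ≤ m := (Finset.mem_range.1 hi).le
  have hpow : ε p ^ m = ε p ^ i * ε p ^ (m - i) := by rw [← pow_add, Nat.add_sub_cancel' him]
  rw [abs_mul, hpow]
  calc |A i p| * |g i p - ∑ j ∈ Finset.range (m - i), b i j p|
      ≤ (D i * ε p ^ i) * (G i (m - i) * ε p ^ (m - i)) :=
        mul_le_mul (hD i p) (hG i _ p) (abs_nonneg _) ((abs_nonneg _).trans (hD i p))
    _ = _ := by ring

theorem exists_sqrt_one_sub_bound (m : ℕ) :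
    ∃ C : ℝ, 0 ≤ C ∧ ∀ x : ℝ, |x| ≤ 1 / 2 →
      |Real.sqrt (1 - x) - ∑ j ∈ Finset.range m, coeffC 0 j * x ^ j| ≤ C * |x| ^ m := by
  obtain ⟨C, hC, h⟩ := exists_taylor_bound (-(1 / 2)) m
  refine ⟨C, hC, fun x hx => ?_⟩
  have h1 := h x hx
  have hx' : 0 ≤ 1 - x := by linarith [(abs_le.1 hx).2]
  rw [Real.rpow_neg hx', one_div, inv_inv, ← Real.sqrt_eq_rpow] at h1
  simpa only [coeffC, Nat.cast_zero, zero_sub] using h1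

/-- The function is (1-x)^(-(l-1/2)), whose binomial coefficients are c^(l)_j. It is the l-th
coefficient that arises when √(1-x-z) is expanded in z. -/
theorem exists_one_sub_rpow_bound (l m : ℕ) :
    ∃ C : ℝ, 0 ≤ C ∧ ∀ x : ℝ, |x| ≤ 1 / 2 →
      |Real.sqrt (1 - x) / (1 - x) ^ l - ∑ j ∈ Finset.range m, coeffC l j * x ^ j| ≤
        C * |x| ^ m := by
  obtain ⟨C, hC, h⟩ := exists_taylor_bound ((l : ℝ) - 1 / 2) m
  refine ⟨C, hC, fun x hx => ?_⟩
  have h1 := h x hx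
  have hx' : 0 < 1 - x := by linarith [(abs_le.1 hx).2]
  rw [Real.rpow_sub hx', ← Real.sqrt_eq_rpow, one_div_div, Real.rpow_natCast] at h1
  exact h1

/-- The parameters `(λ, z, ε)` with `|λ|, |z| ≤ ε ≤ 1/4`. -/
abbrev SmallParam : Type :=
  {p : ℝ × ℝ × ℝ // |p.1| ≤ p.2.2 ∧ |p.2.1| ≤ p.2.2 ∧ p.2.2 ≤ 1 / 4}

/-- Factor √(1-x-z) = √(1-x) √(1 - z/(1-x)), expand the second root in z/(1-x), and then each
√(1-x)/(1-x)^l in x. This produces the products c^(0)_l c^(l)_{n-l}. -/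
theorem exists_sqrt_two_variables_bound (m : ℕ) :
    ∃ C, ∀ p : SmallParam, |Real.sqrt (1 - p.1.1 - p.1.2.1) -
      ∑ n ∈ Finset.range m, ∑ l ∈ Finset.range (n + 1),
        (coeffC 0 l * p.1.2.1 ^ l) * (coeffC l (n - l) * p.1.1 ^ (n - l))| ≤ C * p.1.2.2 ^ m := by
  have hε : ∀ p : SmallParam, 0 ≤ p.1.2.2 := fun p => (abs_nonneg _).trans p.2.1
  refine exists_expansion_bound (fun p : SmallParam => p.1.2.2)
    (fun p => Real.sqrt (1 - p.1.1 - p.1.2.1)) (fun l p => coeffC 0 l * p.1.2.1 ^ l)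
    (fun l p => Real.sqrt (1 - p.1.1) / (1 - p.1.1) ^ l) (fun l j p => coeffC l j * p.1.1 ^ j)
    m ?_ ?_ ?_
  · obtain ⟨C, hC, h⟩ := exists_sqrt_one_sub_bound m
    refine ⟨2 * (C * 2 ^ m), ?_⟩
    rintro ⟨⟨x, z, ε⟩, hx, hz, hε'⟩
    simp only at hx hz hε' ⊢
    have hx1 := (abs_le.1 (hx.trans hε')).1
    have hx2 := (abs_le.1 (hx.trans hε')).2
    have h1x : 0 < 1 - x := by linarith
    -- From ε ≤ 1/4 one gets 1 - x ≥ 1/2, and 2ε ≤ 1/2 keeps the quotient in the range of the Taylor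
    -- bound.
    have hw : |z / (1 - x)| ≤ 2 * ε := by
      rw [abs_div, abs_of_pos h1x, div_le_iff₀ h1x]
      nlinarith [abs_nonneg x, abs_nonneg z]
    have h1 := h (z / (1 - x)) (by linarith)
    have e1 : Real.sqrt (1 - x - z) = Real.sqrt (1 - x) * Real.sqrt (1 - z / (1 - x)) := by
      rw [← Real.sqrt_mul h1x.le]
      congr 1
      field_simp
    have e2 : ∑ l ∈ Finset.range m, coeffC 0 l * z ^ l * (Real.sqrt (1 - x) / (1 - x) ^ l) =
        Real.sqrt (1 - x) * ∑ l ∈ Finset.range m, coeffC 0 l * (z / (1 - x)) ^ l := by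
      rw [Finset.mul_sum]
      refine Finset.sum_congr rfl fun l _ => ?_
      rw [div_pow]
      ring
    have hs : Real.sqrt (1 - x) ≤ 2 := by
      rw [Real.sqrt_le_left (by norm_num)]
      linarith
    rw [e1, e2, ← mul_sub, abs_mul, abs_of_nonneg (Real.sqrt_nonneg _)]
    calc _ ≤ 2 * (C * |z / (1 - x)| ^ m) := mul_le_mul hs h1 (abs_nonneg _) (by norm_num)
      _ ≤ 2 * (C * (2 * ε) ^ m) := by gcongr
      _ = _ := by rw [mul_pow]; ring
  · refine fun i => ⟨|coeffC 0 i|, fun p => ?_⟩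
    rw [abs_mul, abs_pow]
    exact mul_le_mul_of_nonneg_left (pow_le_pow_left₀ (abs_nonneg _) p.2.2.1 _) (abs_nonneg _)
  · intro i r
    obtain ⟨C, hC, h⟩ := exists_one_sub_rpow_bound i r
    refine ⟨C, fun p => (h p.1.1 (by linarith [p.2.1, p.2.2.2])).trans ?_⟩
    exact mul_le_mul_of_nonneg_left (pow_le_pow_left₀ (abs_nonneg _) p.2.1 _) hC

/-- Collecting by the total power ν = i + l of z leaves x^(n-ν), and the sum over i + l = ν is the
definition of d_{n,ν} with its summation index reflected. -/
theorem sum_coeffD_eq (x z : ℝ) (n : ℕ) :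
    ∑ i ∈ Finset.range (n + 1), (coeffC 0 i * z ^ i) *
        ∑ l ∈ Finset.range (n - i + 1),
          (coeffC 0 l * z ^ l) * (coeffC l (n - i - l) * x ^ (n - i - l)) =
      ∑ ν ∈ Finset.range (n + 1), coeffD n ν * z ^ ν * x ^ (n - ν) := by
  have h1 : ∀ ν ∈ Finset.range (n + 1), coeffD n ν * z ^ ν * x ^ (n - ν) =
      ∑ i ∈ Finset.range (ν + 1), (fun i l => (coeffC 0 i * z ^ i) *
        ((coeffC 0 l * z ^ l) * (coeffC l (n - i - l) * x ^ (n - i - l)))) i (ν - i) := by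
    intro ν hν
    rw [coeffD, ← Finset.sum_range_reflect, Finset.sum_mul, Finset.sum_mul]
    refine Finset.sum_congr rfl fun i hi => ?_
    have hi' : i ≤ ν := Nat.lt_succ_iff.1 (Finset.mem_range.1 hi)
    have e1 : ν + 1 - 1 - i = ν - i := by omega
    have e2 : ν - (ν - i) = i := by omega
    have e3 : n - i - (ν - i) = n - ν := by omega
    have e4 : z ^ ν = z ^ i * z ^ (ν - i) := by rw [← pow_add, Nat.add_sub_cancel' hi']
    simp only [e1, e2, e3, e4]
    ring
  rw [Finset.sum_congr rfl h1, Finset.sum_range_diag_flip (n + 1) (fun i l => (coeffC 0 i * z ^ i) *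
    ((coeffC 0 l * z ^ l) * (coeffC l (n - i - l) * x ^ (n - i - l))))]
  refine Finset.sum_congr rfl fun i hi => ?_
  have hi' : i ≤ n := Nat.lt_succ_iff.1 (Finset.mem_range.1 hi)
  rw [Finset.mul_sum, Nat.sub_add_comm hi']

/-- A second use of `exists_expansion_bound`: the outer expansion is that of √(1-z), and the inner
function √(1-x-z) is the same for every outer index. -/
theorem exists_sqrt_product_bound (m : ℕ) :
    ∃ C, ∀ p : SmallParam, |Real.sqrt (1 - p.1.2.1) * Real.sqrt (1 - p.1.1 - p.1.2.1) -
      ∑ n ∈ Finset.range m, ∑ ν ∈ Finset.range (n + 1),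
        coeffD n ν * p.1.2.1 ^ ν * p.1.1 ^ (n - ν)| ≤ C * p.1.2.2 ^ m := by
  have hε : ∀ p : SmallParam, 0 ≤ p.1.2.2 := fun p => (abs_nonneg _).trans p.2.1
  simp only [← sum_coeffD_eq]
  refine exists_expansion_bound (fun p : SmallParam => p.1.2.2)
    (fun p => Real.sqrt (1 - p.1.2.1) * Real.sqrt (1 - p.1.1 - p.1.2.1))
    (fun l p => coeffC 0 l * p.1.2.1 ^ l) (fun _ p => Real.sqrt (1 - p.1.1 - p.1.2.1))
    (fun _ j p => ∑ l ∈ Finset.range (j + 1),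
      (coeffC 0 l * p.1.2.1 ^ l) * (coeffC l (j - l) * p.1.1 ^ (j - l))) m ?_ ?_ ?_
  · obtain ⟨C, hC, h⟩ := exists_sqrt_one_sub_bound m
    refine ⟨C * 2, ?_⟩
    rintro ⟨⟨x, z, ε⟩, hx, hz, hε'⟩
    simp only at hx hz hε' ⊢
    have hs : Real.sqrt (1 - x - z) ≤ 2 := by
      rw [Real.sqrt_le_left (by norm_num)]
      linarith [(abs_le.1 (hx.trans hε')).1, (abs_le.1 (hz.trans hε')).1]
    rw [← Finset.sum_mul, ← sub_mul, abs_mul, abs_of_nonneg (Real.sqrt_nonneg _)]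
    have hε0 : 0 ≤ ε := (abs_nonneg _).trans hx
    calc _ ≤ (C * |z| ^ m) * 2 :=
          mul_le_mul (h z (by linarith)) hs (Real.sqrt_nonneg _) (by positivity)
      _ ≤ (C * ε ^ m) * 2 := by gcongr
      _ = _ := by ring
  · refine fun i => ⟨|coeffC 0 i|, fun p => ?_⟩
    rw [abs_mul, abs_pow]
    exact mul_le_mul_of_nonneg_left (pow_le_pow_left₀ (abs_nonneg _) p.2.2.1 _) (abs_nonneg _)
  · exact fun _ r => exists_sqrt_two_variables_bound r

/-! ### Taylor remainders uniform in the particle number -/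

/-- The coefficient polynomial of `𝕂^(2)` in `ℍ^(2n)`. -/
def polyTwo (n k : ℕ) : ℝ :=
  ∑ ν ∈ Finset.range (n + 1), coeffD n ν * ((k : ℝ) - 1) ^ ν

theorem abs_sub_one_le (k : ℕ) : |(k : ℝ) - 1| ≤ (k : ℝ) + 1 := by
  have hk : (0 : ℝ) ≤ k := k.cast_nonneg
  rw [abs_le]
  constructor <;> linarith

theorem exists_polyTwo_bound (n : ℕ) :
    ∃ C : ℝ, 0 ≤ C ∧ ∀ k : ℕ, |polyTwo n k| ≤ C * ((k : ℝ) + 1) ^ n := by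
  refine ⟨∑ ν ∈ Finset.range (n + 1), |coeffD n ν|,
    Finset.sum_nonneg fun _ _ => abs_nonneg _, fun k => ?_⟩
  rw [polyTwo, Finset.sum_mul]
  refine (Finset.abs_sum_le_sum_abs _ _).trans (Finset.sum_le_sum fun ν hν => ?_)
  rw [abs_mul, abs_pow]
  have hk : (0 : ℝ) ≤ k := k.cast_nonneg
  refine mul_le_mul_of_nonneg_left ?_ (abs_nonneg _)
  exact (pow_le_pow_left₀ (abs_nonneg _) (abs_sub_one_le k) _).trans
    (pow_le_pow_right₀ (by linarith) (Nat.lt_succ_iff.1 (Finset.mem_range.1 hν)))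

/-- Outside the Taylor regime 1 ≤ 4x(k+1), so a term of order n < m can be raised to order m at the
price of a factor 4^(m-n). -/
theorem exists_sum_bound_of_quarter_le (m : ℕ) (D : ℕ → ℕ → ℝ)
    (hD : ∀ n, ∃ C : ℝ, 0 ≤ C ∧ ∀ k : ℕ, |D n k| ≤ C * ((k : ℝ) + 1) ^ n) :
    ∃ C : ℝ, 0 ≤ C ∧ ∀ (x : ℝ) (k : ℕ), 0 ≤ x → 1 / 4 ≤ x * ((k : ℝ) + 1) →
      |∑ n ∈ Finset.range m, x ^ n * D n k| ≤ C * (x * ((k : ℝ) + 1)) ^ m := by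
  choose C hC h using hD
  refine ⟨∑ n ∈ Finset.range m, C n * 4 ^ (m - n),
    Finset.sum_nonneg fun n _ => mul_nonneg (hC n) (by positivity), fun x k hx hxk => ?_⟩
  rw [Finset.sum_mul]
  refine (Finset.abs_sum_le_sum_abs _ _).trans (Finset.sum_le_sum fun n hn => ?_)
  have hnm : n ≤ m := (Finset.mem_range.1 hn).le
  rw [abs_mul, abs_of_nonneg (pow_nonneg hx n)]
  have h4 : 1 ≤ 4 ^ (m - n) * (x * ((k : ℝ) + 1)) ^ (m - n) := by
    rw [← mul_pow]
    exact one_le_pow₀ (by linarith)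
  calc x ^ n * |D n k| ≤ x ^ n * (C n * ((k : ℝ) + 1) ^ n) :=
        mul_le_mul_of_nonneg_left (h n k) (pow_nonneg hx n)
    _ = C n * (x * ((k : ℝ) + 1)) ^ n * 1 := by rw [mul_pow]; ring
    _ ≤ C n * (x * ((k : ℝ) + 1)) ^ n * (4 ^ (m - n) * (x * ((k : ℝ) + 1)) ^ (m - n)) :=
        mul_le_mul_of_nonneg_left h4 (mul_nonneg (hC n) (by positivity))
    _ = C n * 4 ^ (m - n) * ((x * ((k : ℝ) + 1)) ^ n * (x * ((k : ℝ) + 1)) ^ (m - n)) := by ring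
    _ = _ := by rw [← pow_add, Nat.add_sub_cancel' hnm]

/-- Expansion of `√([(1 - λ(k - 1))(1 - λk)]_+)` in powers of `λ`. -/
theorem exists_remainder_two_bound (m : ℕ) :
    ∃ C : ℝ, 0 ≤ C ∧ ∀ (x : ℝ) (k : ℕ), 0 ≤ x →
      |Real.sqrt (max ((1 - x * ((k : ℝ) - 1)) * (1 - x * k)) 0) -
        ∑ n ∈ Finset.range (m + 1), x ^ n * polyTwo n k| ≤
        C * (x * ((k : ℝ) + 1)) ^ (m + 1) := by
  obtain ⟨C₁, h₁⟩ := exists_sqrt_product_bound (m + 1)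
  obtain ⟨C₂, hC₂, h₂⟩ := exists_sum_bound_of_quarter_le (m + 1) polyTwo exists_polyTwo_bound
  refine ⟨max C₁ 0 + (5 * 4 ^ m + C₂), by positivity, fun x k hx => ?_⟩
  have hk : (0 : ℝ) ≤ k := k.cast_nonneg
  have hxk : 0 ≤ x * k := mul_nonneg hx hk
  set ε := x * ((k : ℝ) + 1) with hε
  have hε' : ε = x * k + x := by rw [hε]; ring
  have hε0 : 0 ≤ ε := by positivity
  rcases le_total ε (1 / 4) with hsm | hlg
  · have hz : |x * ((k : ℝ) - 1)| ≤ ε := by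
      rw [abs_mul, abs_of_nonneg hx]
      exact mul_le_mul_of_nonneg_left (abs_sub_one_le k) hx
    -- With z = x(k-1) the second radicand 1 - x - z equals 1 - xk.
    have h := h₁ ⟨(x, x * ((k : ℝ) - 1), ε), by rw [abs_of_nonneg hx]; linarith, hz, hsm⟩
    simp only at h
    have hz1 := (abs_le.1 hz).2
    have e1 : Real.sqrt (max ((1 - x * ((k : ℝ) - 1)) * (1 - x * k)) 0) =
        Real.sqrt (1 - x * ((k : ℝ) - 1)) * Real.sqrt (1 - x - x * ((k : ℝ) - 1)) := by
      rw [← Real.sqrt_mul (by linarith), max_eq_left]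
      · congr 2
        ring
      · exact mul_nonneg (by linarith) (by linarith)
    have e2 : ∑ n ∈ Finset.range (m + 1), x ^ n * polyTwo n k =
        ∑ n ∈ Finset.range (m + 1), ∑ ν ∈ Finset.range (n + 1),
          coeffD n ν * (x * ((k : ℝ) - 1)) ^ ν * x ^ (n - ν) := by
      refine Finset.sum_congr rfl fun n _ => ?_
      rw [polyTwo, Finset.mul_sum]
      refine Finset.sum_congr rfl fun ν hν => ?_
      have hν' : ν ≤ n := Nat.lt_succ_iff.1 (Finset.mem_range.1 hν)
      have e : x ^ n = x ^ ν * x ^ (n - ν) := by rw [← pow_add, Nat.add_sub_cancel' hν']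
      rw [mul_pow, e]
      ring
    rw [e1, e2]
    refine h.trans (mul_le_mul_of_nonneg_right ?_ (by positivity))
    have : (0 : ℝ) ≤ 5 * 4 ^ m + C₂ := by positivity
    linarith [le_max_left C₁ 0]
  -- Each factor is at most 1 + ε ≤ 5ε in modulus. For large k both factors are negative and the
  -- root grows linearly in ε, so at least one power of ε is needed; hence the order m + 1.
  · have hs : Real.sqrt (max ((1 - x * ((k : ℝ) - 1)) * (1 - x * k)) 0) ≤ 5 * ε := by
      rw [Real.sqrt_le_left (by positivity)]
      refine max_le ?_ (by positivity)
      have h3 : |1 - x * ((k : ℝ) - 1)| ≤ 5 * ε := by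
        rw [abs_le]
        constructor <;> nlinarith
      have h4 : |1 - x * (k : ℝ)| ≤ 5 * ε := by
        rw [abs_le]
        constructor <;> nlinarith
      rw [sq]
      refine (le_abs_self _).trans ?_
      rw [abs_mul]
      exact mul_le_mul h3 h4 (abs_nonneg _) (by positivity)
    have h5 : 5 * ε ≤ 5 * 4 ^ m * ε ^ (m + 1) := by
      have : 1 ≤ (4 * ε) ^ m := one_le_pow₀ (by linarith)
      calc 5 * ε = 5 * ε * 1 := by ring
        _ ≤ 5 * ε * (4 * ε) ^ m := mul_le_mul_of_nonneg_left this (by positivity)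
        _ = _ := by rw [mul_pow]; ring
    refine (abs_sub _ _).trans ?_
    rw [abs_of_nonneg (Real.sqrt_nonneg _)]
    have h6 := h₂ x k hx hlg
    have h7 : 0 ≤ max C₁ 0 * ε ^ (m + 1) := by positivity
    rw [add_mul, add_mul]
    linarith

/-- Expansion of `√([1 - λ(k - 1)]_+)` in powers of `λ`. -/
theorem exists_remainder_one_bound (m : ℕ) :
    ∃ C : ℝ, 0 ≤ C ∧ ∀ (x : ℝ) (k : ℕ), 0 ≤ x → x ≤ 1 →
      |Real.sqrt (max (1 - x * ((k : ℝ) - 1)) 0) -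
        ∑ n ∈ Finset.range m, x ^ n * (coeffC 0 n * ((k : ℝ) - 1) ^ n)| ≤
        C * (x * ((k : ℝ) + 1)) ^ m := by
  obtain ⟨C₁, hC₁, h₁⟩ := exists_sqrt_one_sub_bound m
  obtain ⟨C₂, hC₂, h₂⟩ := exists_sum_bound_of_quarter_le m
    (fun n k => coeffC 0 n * ((k : ℝ) - 1) ^ n) (fun n => ⟨|coeffC 0 n|, abs_nonneg _, fun k => by
      rw [abs_mul, abs_pow]
      exact mul_le_mul_of_nonneg_left
        (pow_le_pow_left₀ (abs_nonneg _) (abs_sub_one_le k) _) (abs_nonneg _)⟩)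
  refine ⟨C₁ + (2 * 4 ^ m + C₂), by positivity, fun x k hx hx1 => ?_⟩
  have hk : (0 : ℝ) ≤ k := k.cast_nonneg
  have hxk : 0 ≤ x * k := mul_nonneg hx hk
  set ε := x * ((k : ℝ) + 1) with hε
  have hε0 : 0 ≤ ε := by positivity
  rcases le_total ε (1 / 4) with hsm | hlg
  · have hz : |x * ((k : ℝ) - 1)| ≤ ε := by
      rw [abs_mul, abs_of_nonneg hx]
      exact mul_le_mul_of_nonneg_left (abs_sub_one_le k) hx
    have h := h₁ (x * ((k : ℝ) - 1)) (by linarith)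
    rw [max_eq_left (by linarith [(abs_le.1 hz).2])]
    have e : ∑ n ∈ Finset.range m, x ^ n * (coeffC 0 n * ((k : ℝ) - 1) ^ n) =
        ∑ n ∈ Finset.range m, coeffC 0 n * (x * ((k : ℝ) - 1)) ^ n := by
      refine Finset.sum_congr rfl fun n _ => ?_
      rw [mul_pow]
      ring
    rw [e]
    refine h.trans ?_
    have h8 : (0 : ℝ) ≤ 2 * 4 ^ m + C₂ := by positivity
    refine mul_le_mul (by linarith) (pow_le_pow_left₀ (abs_nonneg _) hz _) (by positivity)
      (by positivity)
  -- The radicand is at most 1 + x, attained at k = 0, and x ≤ 1. This root stays bounded, so the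
  -- order m = 0 is allowed.
  · have hs : Real.sqrt (max (1 - x * ((k : ℝ) - 1)) 0) ≤ 2 := by
      rw [Real.sqrt_le_left (by norm_num)]
      refine max_le ?_ (by norm_num)
      nlinarith
    have h5 : 2 ≤ 2 * 4 ^ m * ε ^ m := by
      have : 1 ≤ (4 * ε) ^ m := one_le_pow₀ (by linarith)
      rw [mul_pow] at this
      linarith
    refine (abs_sub _ _).trans ?_
    rw [abs_of_nonneg (Real.sqrt_nonneg _)]
    have h6 := h₂ x k hx hlg
    have h7 : 0 ≤ C₁ * ε ^ m := by positivity
    rw [add_mul, add_mul]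
    linarith

end BoseGas

end

noncomputable section

namespace BoseGas

/-! ## Norm bounds for the kernels -/

theorem norm_comp_le_of_le {E F G : Type*} [NormedAddCommGroup E] [NormedAddCommGroup F]
    [NormedAddCommGroup G] [NormedSpace ℂ E] [NormedSpace ℂ F] [NormedSpace ℂ G]
    {f : F →L[ℂ] G} {g : E →L[ℂ] F} {a b : ℝ} (hf : ‖f‖ ≤ a) (hg : ‖g‖ ≤ b) :
    ‖f.comp g‖ ≤ a * b :=
  (f.opNorm_comp_le g).trans (mul_le_mul hf hg (norm_nonneg _) ((norm_nonneg _).trans hf))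

theorem norm_tensor_le {d k : ℕ} (f : OneBody d) : ‖tensor d k f‖ ≤ ‖f‖ :=
  LinearMap.mkContinuous_norm_le _ (norm_nonneg f) _

theorem norm_mulOp_le {d k : ℕ} {w : (Fin k → Pos d) → ℝ} {M : ℝ} (hM : ∀ x, |w x| ≤ M)
    (hM0 : 0 ≤ M) : ‖mulOp d k w‖ ≤ M := by
  by_cases h : MemLp (fun x => (w x : ℂ)) (⊤ : ℝ≥0∞) (volume : Measure (Fin k → Pos d))
  · refine ContinuousLinearMap.opNorm_le_bound _ hM0 fun ψ => ?_
    refine Lp.norm_le_mul_norm_of_ae_le_mul ?_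
    filter_upwards [coeFn_mulOp h ψ] with x hx
    rw [hx, norm_mul, Complex.norm_real, Real.norm_eq_abs]
    exact mul_le_mul_of_nonneg_right (hM x) (norm_nonneg _)
  -- Here the multiplier is not in L^∞ and `mulOp` takes its default value 0.
  · rw [mulOp, dif_neg h, norm_zero]
    exact hM0

theorem norm_swap01_le (d m : ℕ) : ‖swap01 d m‖ ≤ 1 :=
  (relabel d (m + 2) (Equiv.swap 0 1)).norm_toContinuousLinearMap_le

theorem norm_adjoint_tensor_le {d m : ℕ} {φ : OneBody d} (hφ : ‖φ‖ = 1) :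
    ‖ContinuousLinearMap.adjoint (tensor d m φ)‖ ≤ 1 := by
  rw [LinearIsometryEquiv.norm_map]
  exact (norm_tensor_le φ).trans hφ.le

/-- The triangle inequality is enough: only uniformity in φ matters, not the sharp constant 1 of a
projection. -/
theorem norm_q1_le {d m : ℕ} {φ : OneBody d} (hφ : ‖φ‖ = 1) : ‖q1 d m φ‖ ≤ 2 := by
  refine (norm_sub_le _ _).trans ?_
  have h1 := norm_comp_le_of_le ((norm_tensor_le (k := m) φ).trans hφ.le)
    (norm_adjoint_tensor_le (m := m) hφ)
  have h2 := ContinuousLinearMap.norm_id_le (𝕜 := ℂ) (E := L2 d (m + 1))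
  linarith

theorem norm_q2_le {d m : ℕ} {φ : OneBody d} (hφ : ‖φ‖ = 1) : ‖q2 d m φ‖ ≤ 2 := by
  have h := norm_comp_le_of_le (norm_swap01_le d m)
    (norm_comp_le_of_le (norm_q1_le (m := m + 1) hφ) (norm_swap01_le d m))
  refine h.trans (by norm_num)

theorem integral_norm_sq_eq {d : ℕ} (φ : OneBody d) : ∫ x, ‖φ x‖ ^ 2 = ‖φ‖ ^ 2 := by
  have h1 := L2.inner_def (𝕜 := ℂ) φ φ
  simp only [inner_self_eq_norm_sq_to_K] at h1
  have h2 : ∫ x, ((‖φ x‖ : ℂ)) ^ 2 = ((∫ x, ‖φ x‖ ^ 2 : ℝ) : ℂ) := by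
    rw [← integral_complex_ofReal]
    simp
  have h3 : ((∫ x, ‖φ x‖ ^ 2 : ℝ) : ℂ) = ((‖φ‖ ^ 2 : ℝ) : ℂ) := by
    rw [← h2]
    push_cast
    exact h1.symm
  exact_mod_cast h3

/-- |φ|² is a probability density. Used for `meanField`, and then again for `chemPot` with the mean
field as f. -/
theorem abs_integral_mul_norm_sq_le {d : ℕ} {φ : OneBody d} (hφ : ‖φ‖ = 1) {f : Pos d → ℝ} {M : ℝ}
    (hf : ∀ x, |f x| ≤ M) : |∫ y, f y * ‖φ y‖ ^ 2| ≤ M := by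
  have hi : Integrable (fun y => M * ‖φ y‖ ^ 2) volume :=
    ((Lp.memLp φ).integrable_norm_pow (by norm_num)).const_mul M
  have h := norm_integral_le_of_norm_le hi (f := fun y => f y * ‖φ y‖ ^ 2)
    (Eventually.of_forall fun y => by
      rw [norm_mul, Real.norm_eq_abs, norm_pow, norm_norm]
      exact mul_le_mul_of_nonneg_right (hf y) (by positivity))
  rwa [integral_const_mul, integral_norm_sq_eq, hφ, one_pow, mul_one] at h

section kernels

variable {d : ℕ} {v : Pos d → ℝ} {φ : OneBody d} {M : ℝ}

theorem abs_potW_le (hv : ∀ x, |v x| ≤ M) (hφ : ‖φ‖ = 1) (x y : Pos d) :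
    |potW v φ x y| ≤ 4 * M := by
  have h1 : ∀ x, |meanField v φ x| ≤ M := fun x =>
    abs_integral_mul_norm_sq_le hφ fun y => hv (x - y)
  have h2 := abs_le.1 (abs_integral_mul_norm_sq_le hφ h1)
  have h3 := abs_le.1 (h1 x)
  have h4 := abs_le.1 (h1 y)
  have h5 := abs_le.1 (hv (x - y))
  rw [potW, chemPot, abs_le]
  constructor <;> linarith [h2.1, h2.2]

/-- The constant 64 is that of `kernelK4`, with four projections bounded by 2 and a potential
bounded by 4M; it serves for all four kernels. -/
theorem norm_kernelK1_le (hv : ∀ x, |v x| ≤ M) (hM : 0 ≤ M) (hφ : ‖φ‖ = 1) (m : ℕ) :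
    ‖kernelK1 d v φ m‖ ≤ 64 * M := by
  have ht : ∀ m, ‖tensor d m φ‖ ≤ 1 := fun m => (norm_tensor_le φ).trans hφ.le
  have hw := norm_mulOp_le (k := m + 2) (w := fun x => v (x 0 - x 1)) (fun x => hv _) hM
  have h := norm_comp_le_of_le (norm_q1_le (m := m) hφ) (norm_comp_le_of_le
    (norm_comp_le_of_le (norm_adjoint_tensor_le (m := m + 1) hφ) (norm_comp_le_of_le hw
      (norm_comp_le_of_le (norm_swap01_le d m) (ht (m + 1))))) (norm_q1_le (m := m) hφ))
  exact h.trans (by linarith)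

theorem norm_kernelK2_le (hv : ∀ x, |v x| ≤ M) (hM : 0 ≤ M) (hφ : ‖φ‖ = 1) (m : ℕ) :
    ‖kernelK2 d v φ m‖ ≤ 64 * M := by
  have ht : ∀ m, ‖tensor d m φ‖ ≤ 1 := fun m => (norm_tensor_le φ).trans hφ.le
  have hw := norm_mulOp_le (k := m + 2) (w := fun x => v (x 0 - x 1)) (fun x => hv _) hM
  have h := norm_comp_le_of_le (norm_q1_le (m := m + 1) hφ) (norm_comp_le_of_le
    (norm_q2_le (m := m) hφ) (norm_comp_le_of_le hw (norm_comp_le_of_le (ht (m + 1)) (ht m))))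
  exact h.trans (by linarith)

theorem norm_kernelK3_le (hv : ∀ x, |v x| ≤ M) (hM : 0 ≤ M) (hφ : ‖φ‖ = 1) (m : ℕ) :
    ‖kernelK3 d v φ m‖ ≤ 64 * M := by
  have ht : ∀ m, ‖tensor d m φ‖ ≤ 1 := fun m => (norm_tensor_le φ).trans hφ.le
  have hw := norm_mulOp_le (k := m + 2) (w := fun x => potW v φ (x 0) (x 1))
    (fun x => abs_potW_le hv hφ _ _) (by positivity)
  have h := norm_comp_le_of_le (norm_q1_le (m := m + 1) hφ) (norm_comp_le_of_le
    (norm_q2_le (m := m) hφ) (norm_comp_le_of_le hw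
      (norm_comp_le_of_le (ht (m + 1)) (norm_q1_le (m := m) hφ))))
  exact h.trans (by linarith)

theorem norm_kernelK4_le (hv : ∀ x, |v x| ≤ M) (hM : 0 ≤ M) (hφ : ‖φ‖ = 1) (m : ℕ) :
    ‖kernelK4 d v φ m‖ ≤ 64 * M := by
  have hw := norm_mulOp_le (k := m + 2) (w := fun x => potW v φ (x 0) (x 1))
    (fun x => abs_potW_le hv hφ _ _) (by positivity)
  have h := norm_comp_le_of_le (norm_q1_le (m := m + 1) hφ) (norm_comp_le_of_le
    (norm_q2_le (m := m) hφ) (norm_comp_le_of_le hw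
      (norm_comp_le_of_le (norm_q1_le (m := m + 1) hφ) (norm_q2_le (m := m) hφ))))
  exact h.trans (by linarith)

end kernels

/-! ### Growth of second-quantized operators with the particle number -/

theorem factorial_add_le (m n : ℕ) (hn : n ≤ 2) :
    ((m + n).factorial : ℝ) ≤ (m.factorial : ℝ) * (3 * ((m : ℝ) + 1)) ^ n := by
  have h := Nat.factorial_mul_ascFactorial m n
  have h2 := Nat.ascFactorial_le_pow_add m n
  have h3 : ((m + n : ℕ) : ℝ) ≤ 3 * ((m : ℝ) + 1) := by
    have : (n : ℝ) ≤ 2 := by exact_mod_cast hn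
    have hm : (0 : ℝ) ≤ m := m.cast_nonneg
    push_cast
    linarith
  rw [← h]
  push_cast
  refine mul_le_mul_of_nonneg_left ?_ (by positivity)
  calc ((m + 1).ascFactorial n : ℝ) ≤ (((m + n) ^ n : ℕ) : ℝ) := by exact_mod_cast h2
    _ = ((m + n : ℕ) : ℝ) ^ n := by push_cast; ring
    _ ≤ _ := pow_le_pow_left₀ (Nat.cast_nonneg _) h3 n

/-- The combinatorial factor is the root of (m+1)⋯(m+p) · (m+1)⋯(m+n), that is, of n + p factors of
size at most 3(m+1). As (n+p)/2 ≤ 2, the powers of 3 are absorbed in 9; the inclusion and the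
symmetrization are contractions. -/
theorem norm_secondQuantComponent_le {d n p : ℕ} (hn : n ≤ 2) (hp : p ≤ 2)
    {T : ∀ m, L2 d (m + p) →L[ℂ] L2 d (m + n)} {B : ℝ} (hT : ∀ m, ‖T m‖ ≤ B) (m : ℕ) :
    ‖secondQuantComponent n p T m‖ ≤ 9 * B * ((m : ℝ) + 1) ^ (((n : ℝ) + p) / 2) := by
  have hB : 0 ≤ B := (norm_nonneg _).trans (hT m)
  have hm1 : (0 : ℝ) < (m : ℝ) + 1 := by positivity
  have hf : (0 : ℝ) < m.factorial := by exact_mod_cast m.factorial_pos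
  have hnp : ((n : ℝ) + p) / 2 ≤ 2 := by
    have h1 : (n : ℝ) ≤ 2 := by exact_mod_cast hn
    have h2 : (p : ℝ) ≤ 2 := by exact_mod_cast hp
    linarith
  have hw : Real.sqrt (((m + p).factorial : ℝ) * ((m + n).factorial : ℝ)) / (m.factorial : ℝ) ≤
      9 * ((m : ℝ) + 1) ^ (((n : ℝ) + p) / 2) := by
    rw [div_le_iff₀ hf]
    have h1 : Real.sqrt (((m + p).factorial : ℝ) * ((m + n).factorial : ℝ)) ≤
        (m.factorial : ℝ) * (3 * ((m : ℝ) + 1)) ^ (((n : ℝ) + p) / 2) := by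
      rw [Real.sqrt_le_left (by positivity)]
      refine (mul_le_mul (factorial_add_le m p hp) (factorial_add_le m n hn) (by positivity)
        (by positivity)).trans (le_of_eq ?_)
      have e : ((3 * ((m : ℝ) + 1)) ^ (((n : ℝ) + p) / 2)) ^ 2 =
          (3 * ((m : ℝ) + 1)) ^ (n + p) := by
        rw [← Real.rpow_natCast, ← Real.rpow_mul (by positivity), ← Real.rpow_natCast]
        congr 1
        push_cast
        ring
      rw [mul_pow (m.factorial : ℝ), e, pow_add]
      ring
    refine h1.trans ?_
    rw [Real.mul_rpow (by norm_num) hm1.le]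
    have h2 : (3 : ℝ) ^ (((n : ℝ) + p) / 2) ≤ 9 := by
      calc (3 : ℝ) ^ (((n : ℝ) + p) / 2) ≤ (3 : ℝ) ^ (2 : ℝ) :=
            Real.rpow_le_rpow_of_exponent_le (by norm_num) hnp
        _ = 9 := by norm_num
    have h3 : 0 ≤ ((m : ℝ) + 1) ^ (((n : ℝ) + p) / 2) := by positivity
    rw [mul_comm]
    exact mul_le_mul_of_nonneg_right (mul_le_mul_of_nonneg_right h2 h3) hf.le
  have hproj := norm_comp_le_of_le
    (Submodule.orthogonalProjectionOnto_norm_le (symSubspace d (m + n)))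
    (norm_comp_le_of_le (hT m) (symSubspace d (m + p)).norm_subtypeL_le)
  refine (ContinuousLinearMap.opNorm_smul_le _ _).trans ?_
  rw [Complex.norm_real, Real.norm_of_nonneg (by positivity)]
  calc _ ≤ (9 * ((m : ℝ) + 1) ^ (((n : ℝ) + p) / 2)) * (1 * (B * 1)) :=
        mul_le_mul hw hproj (norm_nonneg _) (by positivity)
    _ = _ := by ring

/-! ## Operators bounded relative to powers of the number operator -/

/-- `A` is defined on the domain of `(𝒩 + 1)^s`, with `‖A ϕ‖ ≤ C ‖(𝒩 + 1)^s ϕ‖`. -/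
def RelBdd {d : ℕ} (A : SeqOp d) (s C : ℝ) : Prop :=
  ∀ ϕ : (numPow d s).domain,
    ∃ h : (ϕ : Fock d) ∈ A.toFock.domain, ‖A.toFock ⟨ϕ, h⟩‖ ≤ C * ‖numPow d s ϕ‖

theorem RelBdd.mono {d : ℕ} {A : SeqOp d} {s C C' : ℝ} (hA : RelBdd A s C) (h : C ≤ C') :
    RelBdd A s C' := fun ϕ => by
  obtain ⟨h1, h2⟩ := hA ϕ
  exact ⟨h1, h2.trans (mul_le_mul_of_nonneg_right h (norm_nonneg _))⟩

/-- Only an extension: cancellations can make the maximal domain of the sum larger than the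
intersection of the domains. -/
theorem toFock_add_le {d : ℕ} (A B : SeqOp d) : A.toFock + B.toFock ≤ (A + B).toFock := by
  refine ⟨fun ϕ hϕ => ?_, ?_⟩
  · exact Memℓp.add hϕ.1 hϕ.2
  · rintro ⟨x, hx⟩ ⟨y, hy⟩ h
    obtain rfl : x = y := h
    rfl

theorem smul_toFock_le {d : ℕ} (c : ℂ) (A : SeqOp d) : c • A.toFock ≤ (c • A).toFock := by
  refine ⟨fun ϕ hϕ => ?_, ?_⟩
  · exact Memℓp.const_smul hϕ c
  · rintro ⟨x, hx⟩ ⟨y, hy⟩ h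
    obtain rfl : x = y := h
    rw [LinearPMap.smul_apply]
    exact lp.ext (funext fun k => rfl)

theorem RelBdd.add {d : ℕ} {A B : SeqOp d} {s C D : ℝ} (hA : RelBdd A s C) (hB : RelBdd B s D) :
    RelBdd (A + B) s (C + D) := fun ϕ => by
  obtain ⟨h1, h2⟩ := hA ϕ
  obtain ⟨h3, h4⟩ := hB ϕ
  refine ⟨(toFock_add_le A B).1 ⟨h1, h3⟩, ?_⟩
  have e : (A + B).toFock ⟨ϕ, (toFock_add_le A B).1 ⟨h1, h3⟩⟩ =
      A.toFock ⟨ϕ, h1⟩ + B.toFock ⟨ϕ, h3⟩ := rfl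
  rw [e, add_mul]
  exact (norm_add_le _ _).trans (add_le_add h2 h4)

theorem RelBdd.smul {d : ℕ} {A : SeqOp d} {s C : ℝ} (c : ℂ) (hA : RelBdd A s C) :
    RelBdd (c • A) s (‖c‖ * C) := fun ϕ => by
  obtain ⟨h1, h2⟩ := hA ϕ
  refine ⟨(smul_toFock_le c A).1 h1, ?_⟩
  have e : (c • A).toFock ⟨ϕ, (smul_toFock_le c A).1 h1⟩ = c • A.toFock ⟨ϕ, h1⟩ :=
    ((smul_toFock_le c A).2 (x := ⟨ϕ, h1⟩) rfl).symm
  rw [e, norm_smul, mul_assoc]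
  exact mul_le_mul_of_nonneg_left h2 (norm_nonneg _)

theorem norm_numPow_apply {d : ℕ} (s : ℝ) (ϕ : (numPow d s).domain) (k : ℕ) :
    ‖numPow d s ϕ k‖ = ((k : ℝ) + 1) ^ s * ‖(ϕ : Fock d) k‖ := by
  have e : numPow d s ϕ k = ((((k : ℝ) + 1) ^ s : ℝ) : ℂ) • (ϕ : Fock d) k := rfl
  rw [e, norm_smul, Complex.norm_real, Real.norm_of_nonneg (by positivity)]

/-- Each output sector m + n is controlled by the single input sector m + p. The square sums can
thus be compared term by term: the first n output terms vanish, and the first p input terms are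
discarded. -/
theorem relBdd_of_sector_bound {d : ℕ} {A : SeqOp d} (n p : ℕ) {s C : ℝ} (hC : 0 ≤ C)
    (hlt : ∀ ϕ k, k < n → A ϕ k = 0)
    (h : ∀ ϕ m, ‖A ϕ (m + n)‖ ≤ C * (((m + p : ℕ) : ℝ) + 1) ^ s * ‖ϕ (m + p)‖) :
    RelBdd A s C := by
  intro ϕ
  set X := numPow d s ϕ with hX
  have h2 : (0 : ℝ) < (2 : ℝ≥0∞).toReal := by norm_num
  have hXs : Summable fun k => ‖X k‖ ^ 2 := by
    simpa using (lp.memℓp X).summable h2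
  have hXn : ‖X‖ ^ 2 = ∑' k, ‖X k‖ ^ 2 := by
    simpa using lp.norm_rpow_eq_tsum h2 X
  have hbd : ∀ m, ‖A (fun k => (ϕ : Fock d) k) (m + n)‖ ^ 2 ≤ C ^ 2 * ‖X (m + p)‖ ^ 2 := by
    intro m
    rw [← mul_pow, norm_numPow_apply, ← mul_assoc]
    exact pow_le_pow_left₀ (norm_nonneg _) (h _ m) 2
  have hXp : Summable fun m => C ^ 2 * ‖X (m + p)‖ ^ 2 :=
    ((summable_nat_add_iff p).2 hXs).mul_left _
  have hAn : Summable fun m => ‖A (fun k => (ϕ : Fock d) k) (m + n)‖ ^ 2 :=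
    hXp.of_nonneg_of_le (fun m => by positivity) hbd
  have hA : Summable fun m => ‖A (fun k => (ϕ : Fock d) k) m‖ ^ 2 :=
    (summable_nat_add_iff (f := fun m => ‖A (fun k => (ϕ : Fock d) k) m‖ ^ 2) n).1 hAn
  have hmem : Memℓp (A (fun k => (ϕ : Fock d) k)) 2 := memℓp_gen (by simpa using hA)
  refine ⟨hmem, lp.norm_le_of_tsum_le h2 (by positivity) ?_⟩
  have e : ∀ k, ‖A.toFock ⟨ϕ, hmem⟩ k‖ ^ (2 : ℝ≥0∞).toReal =
      ‖A (fun k => (ϕ : Fock d) k) k‖ ^ 2 := by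
    intro k
    simp [SeqOp.toFock_apply]
  have e2 : (C * ‖X‖) ^ (2 : ℝ≥0∞).toReal = C ^ 2 * ‖X‖ ^ 2 := by
    simp [mul_pow]
  rw [tsum_congr e, e2, hXn, ← hA.sum_add_tsum_nat_add n, Finset.sum_eq_zero, zero_add]
  · calc _ ≤ ∑' m, C ^ 2 * ‖X (m + p)‖ ^ 2 := hAn.tsum_le_tsum hbd hXp
      _ = C ^ 2 * ∑' m, ‖X (m + p)‖ ^ 2 := tsum_mul_left
      _ ≤ _ := by
        refine mul_le_mul_of_nonneg_left ?_ (by positivity)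
        rw [← hXs.sum_add_tsum_nat_add p]
        exact le_add_of_nonneg_left (Finset.sum_nonneg fun i _ => by positivity)
  · intro k hk
    rw [hlt _ _ (Finset.mem_range.1 hk)]
    simp

section shift

variable {d n p : ℕ} {T : ∀ m, symSubspace d (m + p) →L[ℂ] symSubspace d (m + n)} {g : ℕ → ℝ}
  {W G r t s : ℝ}

theorem weight_le {G W r t s x y z : ℝ} (hW : 0 ≤ W) (hG : 0 ≤ G) (hr : 0 ≤ r)
    (ht : 0 ≤ t) (hs : r + t ≤ s) (hx : 0 < x) (hz : 1 ≤ z) (hxz : x ≤ z) (hy : 0 ≤ y)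
    (hyz : y ≤ z) : G * y ^ t * (W * x ^ r) ≤ G * W * z ^ s := by
  have h1 : y ^ t * x ^ r ≤ z ^ t * z ^ r := by
    refine mul_le_mul (Real.rpow_le_rpow hy hyz ht) (Real.rpow_le_rpow hx.le hxz hr)
      (by positivity) (by positivity)
  rw [← Real.rpow_add (by linarith)] at h1
  have h2 : z ^ (t + r) ≤ z ^ s := Real.rpow_le_rpow_of_exponent_le hz (by linarith)
  calc G * y ^ t * (W * x ^ r) = G * W * (y ^ t * x ^ r) := by ring
    _ ≤ G * W * z ^ s := mul_le_mul_of_nonneg_left (h1.trans h2) (by positivity)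

theorem relBdd_shift_mul_numFun (hW : 0 ≤ W) (hG : 0 ≤ G) (hr : 0 ≤ r) (ht : 0 ≤ t)
    (hs : r + t ≤ s) (hT : ∀ m, ‖T m‖ ≤ W * ((m : ℝ) + 1) ^ r)
    (hg : ∀ k : ℕ, |g k| ≤ G * ((k : ℝ) + 1) ^ t) :
    RelBdd (shift n p T * numFun d g) s (G * W) := by
  refine relBdd_of_sector_bound n p (by positivity) (fun ϕ k hk => shift_apply_of_lt n p T _ hk)
    fun ϕ m => ?_
  have e : (shift n p T * numFun d g) ϕ (m + n) = T m ((g (m + p) : ℂ) • ϕ (m + p)) :=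
    shift_apply_add n p T _ m
  have hp : (0 : ℝ) ≤ p := p.cast_nonneg
  have hm : (0 : ℝ) ≤ m := m.cast_nonneg
  have hz : ((m + p : ℕ) : ℝ) + 1 = m + p + 1 := by push_cast; ring
  have hw := weight_le (x := (m : ℝ) + 1) (y := ((m + p : ℕ) : ℝ) + 1)
    (z := ((m + p : ℕ) : ℝ) + 1) hW hG hr ht hs (by positivity) (by linarith) (by linarith)
    (by positivity) le_rfl
  rw [e, map_smul, norm_smul, Complex.norm_real, Real.norm_eq_abs]
  calc _ ≤ (G * (((m + p : ℕ) : ℝ) + 1) ^ t) * ((W * ((m : ℝ) + 1) ^ r) * ‖ϕ (m + p)‖) :=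
        mul_le_mul (hg _) ((T m).le_of_opNorm_le (hT m) _) (norm_nonneg _) (by positivity)
    _ ≤ _ := by
        rw [← mul_assoc]
        exact mul_le_mul_of_nonneg_right hw (norm_nonneg _)

/-- Here g is evaluated on the output sector m + n; the condition n ≤ p lets the weight of the input
sector dominate it. For operators that raise the particle number, g stands on the right instead. -/
theorem relBdd_numFun_mul_shift (hnp : n ≤ p) (hW : 0 ≤ W) (hG : 0 ≤ G) (hr : 0 ≤ r) (ht : 0 ≤ t)
    (hs : r + t ≤ s) (hT : ∀ m, ‖T m‖ ≤ W * ((m : ℝ) + 1) ^ r)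
    (hg : ∀ k : ℕ, |g k| ≤ G * ((k : ℝ) + 1) ^ t) :
    RelBdd (numFun d g * shift n p T) s (G * W) := by
  refine relBdd_of_sector_bound n p (by positivity) (fun ϕ k hk => ?_) fun ϕ m => ?_
  · have e : (numFun d g * shift n p T) ϕ k = (g k : ℂ) • shift n p T ϕ k := rfl
    rw [e, shift_apply_of_lt n p T _ hk, smul_zero]
  have e : (numFun d g * shift n p T) ϕ (m + n) = (g (m + n) : ℂ) • shift n p T ϕ (m + n) := rfl
  have hnp' : (n : ℝ) ≤ p := by exact_mod_cast hnp
  have hp : (0 : ℝ) ≤ p := p.cast_nonneg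
  have hm : (0 : ℝ) ≤ m := m.cast_nonneg
  have hz : ((m + p : ℕ) : ℝ) + 1 = m + p + 1 := by push_cast; ring
  have hy : ((m + n : ℕ) : ℝ) + 1 = m + n + 1 := by push_cast; ring
  have hw := weight_le (x := (m : ℝ) + 1) (y := ((m + n : ℕ) : ℝ) + 1)
    (z := ((m + p : ℕ) : ℝ) + 1) hW hG hr ht hs (by positivity) (by linarith) (by linarith)
    (by positivity) (by linarith)
  rw [e, shift_apply_add, norm_smul, Complex.norm_real, Real.norm_eq_abs]
  calc _ ≤ (G * (((m + n : ℕ) : ℝ) + 1) ^ t) * ((W * ((m : ℝ) + 1) ^ r) * ‖ϕ (m + p)‖) :=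
        mul_le_mul (hg _) ((T m).le_of_opNorm_le (hT m) _) (norm_nonneg _) (by positivity)
    _ ≤ _ := by
        rw [← mul_assoc]
        exact mul_le_mul_of_nonneg_right hw (norm_nonneg _)

end shift

end BoseGas

end

noncomputable section

namespace BoseGas

/-! ## Operators assembled from `𝕂^(1), …, 𝕂^(4)` with functions of the number operator -/

theorem numFun_add (d : ℕ) (g h : ℕ → ℝ) : numFun d (g + h) = numFun d g + numFun d h := by
  refine LinearMap.ext fun ϕ => funext fun k => ?_
  change (((g k + h k : ℝ)) : ℂ) • ϕ k = (g k : ℂ) • ϕ k + (h k : ℂ) • ϕ k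
  rw [Complex.ofReal_add, add_smul]

theorem numFun_smul (d : ℕ) (c : ℝ) (g : ℕ → ℝ) : numFun d (c • g) = (c : ℂ) • numFun d g := by
  refine LinearMap.ext fun ϕ => funext fun k => ?_
  change ((c * g k : ℝ) : ℂ) • ϕ k = (c : ℂ) • (g k : ℂ) • ϕ k
  rw [Complex.ofReal_mul, mul_smul]

theorem numFun_mul (d : ℕ) (g h : ℕ → ℝ) : numFun d g * numFun d h = numFun d (g * h) := by
  refine LinearMap.ext fun ϕ => funext fun k => ?_
  change (g k : ℂ) • (h k : ℂ) • ϕ k = ((g k * h k : ℝ) : ℂ) • ϕ k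
  rw [Complex.ofReal_mul, mul_smul]

theorem numFun_one (d : ℕ) : numFun d 1 = 1 := by
  refine LinearMap.ext fun ϕ => funext fun k => ?_
  change ((1 : ℝ) : ℂ) • ϕ k = ϕ k
  rw [Complex.ofReal_one, one_smul]

theorem numFun_zero (d : ℕ) : numFun d 0 = 0 := by
  refine LinearMap.ext fun ϕ => funext fun k => ?_
  change ((0 : ℝ) : ℂ) • ϕ k = 0
  rw [Complex.ofReal_zero, zero_smul]

theorem numFun_pow (d : ℕ) (g : ℕ → ℝ) (ν : ℕ) : numFun d g ^ ν = numFun d (g ^ ν) := by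
  induction ν with
  | zero => rw [pow_zero, pow_zero, numFun_one]
  | succ ν ih => rw [pow_succ, ih, numFun_mul, pow_succ]

theorem numFun_sum {ι : Type*} (d : ℕ) (F : Finset ι) (g : ι → ℕ → ℝ) :
    numFun d (∑ i ∈ F, g i) = ∑ i ∈ F, numFun d (g i) := by
  classical
  induction F using Finset.induction_on with
  | empty => rw [Finset.sum_empty, Finset.sum_empty, numFun_zero]
  | insert i F hi ih => rw [Finset.sum_insert hi, Finset.sum_insert hi, numFun_add, ih]

theorem num_sub_smul_one (d : ℕ) (c : ℝ) :
    num d - (c : ℂ) • 1 = numFun d (fun k => (k : ℝ) - c) := by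
  refine LinearMap.ext fun ϕ => funext fun k => ?_
  change (((k : ℝ)) : ℂ) • ϕ k - (c : ℂ) • ϕ k = (((k : ℝ) - c : ℝ) : ℂ) • ϕ k
  rw [Complex.ofReal_sub, sub_smul]

theorem num_sub_one (d : ℕ) : num d - 1 = numFun d (fun k => (k : ℝ) - 1) := by
  simpa using num_sub_smul_one d 1

variable {d : ℕ}

/-- `g₁(𝒩) 𝕂^(1) + (𝕂^(2) g₂(𝒩) + h.c.) + (𝕂^(3) g₃(𝒩) + h.c.) + r 𝕂^(4)`, for
`g = ((g₁, g₂), (g₃, r))`. -/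
def assembled (v : Pos d → ℝ) (φ : OneBody d) (g : ((ℕ → ℝ) × (ℕ → ℝ)) × ((ℕ → ℝ) × ℝ)) : SeqOp d :=
  numFun d g.1.1 * opK1 v φ + (opK2 v φ * numFun d g.1.2 + numFun d g.1.2 * opK2bar v φ)
    + (opK3 v φ * numFun d g.2.1 + numFun d g.2.1 * opK3bar v φ) + (g.2.2 : ℂ) • opK4 v φ

variable (v : Pos d → ℝ) (φ : OneBody d)

/-- Linearity in the weights reduces operator identities to identities between scalar functions of
k. -/
theorem assembled_add (g h : ((ℕ → ℝ) × (ℕ → ℝ)) × ((ℕ → ℝ) × ℝ)) :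
    assembled v φ (g + h) = assembled v φ g + assembled v φ h := by
  simp only [assembled, Prod.fst_add, Prod.snd_add, numFun_add, add_mul, mul_add,
    Complex.ofReal_add, add_smul]
  abel

theorem assembled_smul (c : ℝ) (g : ((ℕ → ℝ) × (ℕ → ℝ)) × ((ℕ → ℝ) × ℝ)) :
    assembled v φ (c • g) = (c : ℂ) • assembled v φ g := by
  simp only [assembled, Prod.smul_fst, Prod.smul_snd, numFun_smul, smul_add, smul_mul_assoc,
    mul_smul_comm, smul_eq_mul, Complex.ofReal_mul, mul_smul]

theorem assembled_zero : assembled v φ 0 = 0 := by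
  have h := assembled_smul v φ 0 0
  rwa [zero_smul, Complex.ofReal_zero, zero_smul] at h

theorem assembled_sum {ι : Type*} (F : Finset ι) (g : ι → ((ℕ → ℝ) × (ℕ → ℝ)) × ((ℕ → ℝ) × ℝ)) :
    assembled v φ (∑ i ∈ F, g i) = ∑ i ∈ F, assembled v φ (g i) := by
  classical
  induction F using Finset.induction_on with
  | empty => rw [Finset.sum_empty, Finset.sum_empty, assembled_zero]
  | insert i F hi ih => rw [Finset.sum_insert hi, Finset.sum_insert hi, assembled_add, ih]

/-- The coefficients of `𝕂^(1), …, 𝕂^(4)` in `ℍ^(n)`. -/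
def coeffWeights (n : ℕ) : ((ℕ → ℝ) × (ℕ → ℝ)) × ((ℕ → ℝ) × ℝ) :=
  ((fun k => (if n = 0 then 1 else 0) + (if n = 2 then -((k : ℝ) - 1) else 0),
    fun k => if Even n then polyTwo (n / 2) k else 0),
   (fun k => if Even n then 0 else coeffC 0 (n / 2) * ((k : ℝ) - 1) ^ (n / 2),
    if n = 2 then 1 else 0))

/-- The coefficients of `𝕂^(1), …, 𝕂^(4)` in the excitation Hamiltonian. -/
def excitationWeights (N : ℕ) : ((ℕ → ℝ) × (ℕ → ℝ)) × ((ℕ → ℝ) × ℝ) :=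
  ((fun k => ((N : ℝ) - k) / ((N : ℝ) - 1),
    fun k => Real.sqrt (max (((N : ℝ) - k) * ((N : ℝ) - k - 1)) 0) / ((N : ℝ) - 1)),
   (fun k => Real.sqrt (max ((N : ℝ) - k) 0) / ((N : ℝ) - 1), 1 / ((N : ℝ) - 1)))

theorem excitationRest_eq_assembled (N : ℕ) :
    excitationRest v φ N = assembled v φ (excitationWeights N) := by
  simp [excitationRest, assembled, excitationWeights, sqrtTwo, sqrtOne]

theorem polyTwo_zero (k : ℕ) : polyTwo 0 k = 1 := by
  simp [polyTwo, coeffD, coeffC]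

/-- Since d_{1,0} = -1/2 and d_{1,1} = -1, the factor written out in ℍ^(2) is the general formula at
n = 1. -/
theorem polyTwo_one (k : ℕ) : polyTwo 1 k = -((k : ℝ) - 1 / 2) := by
  simp [polyTwo, coeffD, coeffC, Finset.sum_range_succ]
  ring

/-- For 𝕂^(2) and 𝕂^(3) the separately defined orders 0, 1, 2 fit the general formulas; only 𝕂^(1)
and 𝕂^(4) keep exceptional weights. -/
theorem coeffRest_eq_assembled (n : ℕ) : coeffRest v φ n = assembled v φ (coeffWeights n) := by
  have hz : numFun d (fun _ => (0 : ℝ)) = 0 := numFun_zero d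
  have ho : numFun d (fun _ => (1 : ℝ)) = 1 := numFun_one d
  by_cases h0 : n = 0
  · subst h0
    simp [coeffRest, assembled, coeffWeights, polyTwo_zero, hz, ho]
    abel
  by_cases h1 : n = 1
  · subst h1
    simp [coeffRest, assembled, coeffWeights, coeffC, hz, ho]
  by_cases h2 : n = 2
  · subst h2
    have e1 : numFun d (fun k : ℕ => -((k : ℝ) - 1)) = ((-1 : ℝ) : ℂ) • (num d - 1) := by
      rw [num_sub_one, ← numFun_smul]
      congr 1
      funext k
      simp
    have e2 : numFun d (fun k : ℕ => -((k : ℝ) - 1 / 2)) =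
        ((-1 : ℝ) : ℂ) • (num d - (1 / 2 : ℂ) • 1) := by
      have h := num_sub_smul_one d (1 / 2)
      rw [show ((1 / 2 : ℝ) : ℂ) = 1 / 2 by push_cast; rfl] at h
      rw [h, ← numFun_smul]
      congr 1
      funext k
      simp
    have e3 : coeffWeights 2 = ((fun k : ℕ => -((k : ℝ) - 1),
        fun k : ℕ => -((k : ℝ) - 1 / 2)), ((fun _ : ℕ => (0 : ℝ)), (1 : ℝ))) := by
      simp [coeffWeights, polyTwo_one]
    rw [e3]
    simp only [assembled, e1, e2, hz, coeffRest, if_neg (show (2 : ℕ) ≠ 0 by norm_num),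
      if_neg (show (2 : ℕ) ≠ 1 by norm_num), if_true, smul_mul_assoc, mul_smul_comm, mul_zero,
      zero_mul, Complex.ofReal_one, Complex.ofReal_neg, one_smul, add_zero]
    module
  by_cases he : Even n
  · have e1 : numFun d (fun k => polyTwo (n / 2) k) =
        ∑ ν ∈ Finset.range (n / 2 + 1), (coeffD (n / 2) ν : ℂ) • (num d - 1) ^ ν := by
      have e : (fun k => polyTwo (n / 2) k) = ∑ ν ∈ Finset.range (n / 2 + 1),
          coeffD (n / 2) ν • (fun k : ℕ => (k : ℝ) - 1) ^ ν := by
        funext k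
        simp [polyTwo, Finset.sum_apply]
      rw [e, numFun_sum]
      simp only [numFun_smul, num_sub_one, numFun_pow]
    simp only [coeffRest, assembled, coeffWeights, if_neg h0, if_neg h1, if_neg h2, if_pos he, e1,
      hz, add_zero, zero_mul, mul_zero, zero_add, Complex.ofReal_zero, zero_smul, Finset.sum_mul,
      Finset.mul_sum, smul_add, Finset.sum_add_distrib, smul_mul_assoc, mul_smul_comm]
  · have e1 : numFun d (fun k => coeffC 0 (n / 2) * ((k : ℝ) - 1) ^ (n / 2)) =
        (coeffC 0 (n / 2) : ℂ) • (num d - 1) ^ (n / 2) := by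
      rw [num_sub_one, numFun_pow, ← numFun_smul]
      rfl
    simp only [coeffRest, assembled, coeffWeights, if_neg h0, if_neg h1, if_neg h2, if_neg he, e1,
      hz, add_zero, zero_mul, mul_zero, zero_add, Complex.ofReal_zero, zero_smul, smul_add,
      smul_mul_assoc, mul_smul_comm]

variable {v φ}

/-- Of the s available powers of 𝒩+1, the operators 𝕂^(1), 𝕂^(2) use 1, 𝕂^(3) uses 3/2 and 𝕂^(4)
uses 2; the weights may use the rest. The factor 5 covers the prefactors, which add up to 9/2. -/
theorem relBdd_assembled {M G s : ℝ} (hv : ∀ x, |v x| ≤ M) (hM : 0 ≤ M) (hφ : ‖φ‖ = 1)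
    (hG : 0 ≤ G) (hs : 2 ≤ s) {g : ((ℕ → ℝ) × (ℕ → ℝ)) × ((ℕ → ℝ) × ℝ)}
    (h₁ : ∀ k : ℕ, |g.1.1 k| ≤ G * ((k : ℝ) + 1) ^ (s - 1))
    (h₂ : ∀ k : ℕ, |g.1.2 k| ≤ G * ((k : ℝ) + 1) ^ (s - 1))
    (h₃ : ∀ k : ℕ, |g.2.1 k| ≤ G * ((k : ℝ) + 1) ^ (s - 3 / 2)) (h₄ : |g.2.2| ≤ G) :
    RelBdd (assembled v φ g) s (5 * (9 * (64 * M)) * G) := by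
  have n1 := norm_secondQuantComponent_le (n := 1) (p := 1) (by norm_num) (by norm_num)
    (norm_kernelK1_le hv hM hφ)
  have n2 := norm_secondQuantComponent_le (n := 2) (p := 0) (by norm_num) (by norm_num)
    (norm_kernelK2_le hv hM hφ)
  have n3 := norm_secondQuantComponent_le (n := 2) (p := 1) (by norm_num) (by norm_num)
    (norm_kernelK3_le hv hM hφ)
  have n4 := norm_secondQuantComponent_le (n := 2) (p := 2) (by norm_num) (by norm_num)
    (norm_kernelK4_le hv hM hφ)
  have n2' : ∀ m, ‖ContinuousLinearMap.adjoint (secondQuantComponent 2 0 (kernelK2 d v φ) m)‖ ≤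
      9 * (64 * M) * ((m : ℝ) + 1) ^ ((((2 : ℕ) : ℝ) + (0 : ℕ)) / 2) := fun m => by
    rw [LinearIsometryEquiv.norm_map]
    exact n2 m
  have n3' : ∀ m, ‖ContinuousLinearMap.adjoint (secondQuantComponent 2 1 (kernelK3 d v φ) m)‖ ≤
      9 * (64 * M) * ((m : ℝ) + 1) ^ ((((2 : ℕ) : ℝ) + (1 : ℕ)) / 2) := fun m => by
    rw [LinearIsometryEquiv.norm_map]
    exact n3 m
  have hW : 0 ≤ 9 * (64 * M) := by positivity
  have b1 := relBdd_numFun_mul_shift (s := s) le_rfl hW hG (by positivity) (by linarith)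
    (by push_cast; linarith) n1 h₁
  have b2 := relBdd_shift_mul_numFun (s := s) hW hG (by positivity) (by linarith)
    (by push_cast; linarith) n2 h₂
  have b2' := relBdd_numFun_mul_shift (s := s) (by norm_num) hW hG (by positivity) (by linarith)
    (by push_cast; linarith) n2' h₂
  have b3 := relBdd_shift_mul_numFun (s := s) hW hG (by positivity) (by linarith)
    (by push_cast; linarith) n3 h₃
  have b3' := relBdd_numFun_mul_shift (s := s) (by norm_num) hW hG (by positivity) (by linarith)
    (by push_cast; linarith) n3' h₃
  have b4 := relBdd_shift_mul_numFun (s := s) (t := 0) hW hG (g := fun _ => g.2.2) (by positivity)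
    le_rfl (by push_cast; linarith) n4 (fun k => by simpa using h₄)
  have e : assembled v φ g =
      numFun d g.1.1 * shift 1 1 (secondQuantComponent 1 1 (kernelK1 d v φ))
      + ((1 / 2 : ℂ) • (shift 2 0 (secondQuantComponent 2 0 (kernelK2 d v φ)) * numFun d g.1.2)
        + (1 / 2 : ℂ) • (numFun d g.1.2 * shift 0 2 (fun m => ContinuousLinearMap.adjoint
          (secondQuantComponent 2 0 (kernelK2 d v φ) m))))
      + (shift 2 1 (secondQuantComponent 2 1 (kernelK3 d v φ)) * numFun d g.2.1
        + numFun d g.2.1 * shift 1 2 (fun m => ContinuousLinearMap.adjoint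
          (secondQuantComponent 2 1 (kernelK3 d v φ) m)))
      + (1 / 2 : ℂ) • (shift 2 2 (secondQuantComponent 2 2 (kernelK4 d v φ)) *
          numFun d (fun _ => g.2.2)) := by
    have e4 : numFun d (fun _ => g.2.2) = (g.2.2 : ℂ) • 1 := by
      rw [← numFun_one, ← numFun_smul]
      congr 1
      funext k
      simp
    rw [e4, mul_smul_comm, mul_one, smul_comm (1 / 2 : ℂ) (g.2.2 : ℂ)]
    simp only [assembled, opK1, opK2, opK2bar, opK3, opK3bar, opK4, secondQuant,
      secondQuantAdjoint, smul_mul_assoc, mul_smul_comm]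
  rw [e]
  refine (((b1.add ((b2.smul _).add (b2'.smul _))).add (b3.add b3')).add (b4.smul _)).mono ?_
  have h2 : ‖(1 / 2 : ℂ)‖ = 1 / 2 := by norm_num
  have : 0 ≤ G * (9 * (64 * M)) := by positivity
  rw [h2]
  linarith

/-! ### Relative bounds for the coefficients of the expansion -/

theorem one_le_natCast_add_one (k : ℕ) : (1 : ℝ) ≤ (k : ℝ) + 1 := by
  have hk : (0 : ℝ) ≤ k := k.cast_nonneg
  linarith

theorem pow_le_rpow_of_le {y β : ℝ} (hy : 1 ≤ y) {n : ℕ} (h : (n : ℝ) ≤ β) : y ^ n ≤ y ^ β := by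
  rw [← Real.rpow_natCast]
  exact Real.rpow_le_rpow_of_exponent_le hy h

theorem cast_div_two_le (n : ℕ) : ((n / 2 : ℕ) : ℝ) ≤ n / 2 := by
  have := Nat.cast_div_le (α := ℝ) (m := n) (n := 2)
  simpa using this

/-- Serves only the domain inclusion, so the constant need not be tracked. -/
theorem relBdd_coeffRest {M : ℝ} (hv : ∀ x, |v x| ≤ M) (hM : 0 ≤ M) (hφ : ‖φ‖ = 1) {n a : ℕ}
    (hn : n ≤ a) : ∃ C, RelBdd (coeffRest v φ n) (((a : ℝ) + 4) / 2) C := by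
  obtain ⟨G, hG, h⟩ := exists_polyTwo_bound (n / 2)
  have hn' : (n : ℝ) ≤ a := by exact_mod_cast hn
  have ha : (0 : ℝ) ≤ a := a.cast_nonneg
  have hn2 := cast_div_two_le n
  have hpos : 0 ≤ |coeffC 0 (n / 2)| := abs_nonneg _
  refine ⟨5 * (9 * (64 * M)) * (2 + G + |coeffC 0 (n / 2)|), ?_⟩
  rw [coeffRest_eq_assembled]
  refine relBdd_assembled hv hM hφ (by positivity) (by linarith)
    (fun k => ?_) (fun k => ?_) (fun k => ?_) ?_
  · have h1 : ((k : ℝ) + 1) ^ 1 ≤ ((k : ℝ) + 1) ^ (((a : ℝ) + 4) / 2 - 1) :=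
      pow_le_rpow_of_le (one_le_natCast_add_one k) (by push_cast; linarith)
    have h2 : |(coeffWeights n).1.1 k| ≤ 2 * ((k : ℝ) + 1) ^ 1 := by
      have h3 := one_le_natCast_add_one k
      have h4 := abs_sub_one_le k
      simp only [coeffWeights]
      refine (abs_add_le _ _).trans ?_
      have h5 : |(if n = 0 then 1 else 0 : ℝ)| ≤ 1 := by split_ifs <;> simp
      have h6 : |(if n = 2 then -((k : ℝ) - 1) else 0 : ℝ)| ≤ (k : ℝ) + 1 := by
        split_ifs
        · rwa [abs_neg]
        · rw [abs_zero]; linarith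
      linarith
    refine h2.trans (mul_le_mul (by linarith) h1 (by positivity) (by positivity))
  · have h1 : ((k : ℝ) + 1) ^ (n / 2) ≤ ((k : ℝ) + 1) ^ (((a : ℝ) + 4) / 2 - 1) :=
      pow_le_rpow_of_le (one_le_natCast_add_one k) (by linarith)
    have h2 : |(coeffWeights n).1.2 k| ≤ G * ((k : ℝ) + 1) ^ (n / 2) := by
      simp only [coeffWeights]
      split_ifs
      · exact h k
      · rw [abs_zero]; positivity
    exact h2.trans (mul_le_mul (by linarith) h1 (by positivity) (by positivity))
  · have h1 : ((k : ℝ) + 1) ^ (n / 2) ≤ ((k : ℝ) + 1) ^ (((a : ℝ) + 4) / 2 - 3 / 2) :=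
      pow_le_rpow_of_le (one_le_natCast_add_one k) (by linarith)
    have h2 : |(coeffWeights n).2.1 k| ≤ |coeffC 0 (n / 2)| * ((k : ℝ) + 1) ^ (n / 2) := by
      simp only [coeffWeights]
      split_ifs
      · rw [abs_zero]; positivity
      · rw [abs_mul, abs_pow]
        exact mul_le_mul_of_nonneg_left
          (pow_le_pow_left₀ (abs_nonneg _) (abs_sub_one_le k) _) (abs_nonneg _)
    exact h2.trans (mul_le_mul (by linarith) h1 (by positivity) (by positivity))
  · have h2 : |(coeffWeights n).2.2| ≤ 1 := by
      simp only [coeffWeights]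
      split_ifs <;> simp
    linarith

end BoseGas

end

noncomputable section

namespace BoseGas

/-! ## The remainder of the expansion -/

/-- 𝕂^(2) enters at even orders only and 𝕂^(3) at odd ones; this and `sum_range_odd` reindex the
truncated expansion by integer powers of λ. -/
theorem sum_range_even {M : Type*} [AddCommMonoid M] (f : ℕ → M) (a : ℕ) :
    ∑ n ∈ Finset.range (a + 1), (if Even n then f n else 0) =
      ∑ j ∈ Finset.range (a / 2 + 1), f (2 * j) := by
  induction a with
  | zero => simp
  | succ a ih =>
    rw [Finset.sum_range_succ, ih]
    by_cases h : Even (a + 1)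
    · obtain ⟨b, hb⟩ := h
      rw [if_pos ⟨b, hb⟩, show (a + 1) / 2 + 1 = (a / 2 + 1) + 1 by omega,
        Finset.sum_range_succ _ (a / 2 + 1), show 2 * (a / 2 + 1) = a + 1 by omega]
    · rw [if_neg h, add_zero]
      rw [Nat.not_even_iff] at h
      rw [show (a + 1) / 2 + 1 = a / 2 + 1 by omega]

theorem sum_range_odd {M : Type*} [AddCommMonoid M] (f : ℕ → M) (a : ℕ) :
    ∑ n ∈ Finset.range (a + 1), (if Even n then 0 else f n) =
      ∑ j ∈ Finset.range ((a + 1) / 2), f (2 * j + 1) := by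
  induction a with
  | zero => simp
  | succ a ih =>
    rw [Finset.sum_range_succ, ih]
    by_cases h : Even (a + 1)
    · rw [if_pos h, add_zero]
      rw [Nat.even_iff] at h
      rw [show (a + 1 + 1) / 2 = (a + 1) / 2 by omega]
    · rw [if_neg h]
      rw [Nat.not_even_iff] at h
      rw [show (a + 1 + 1) / 2 = (a + 1) / 2 + 1 by omega, Finset.sum_range_succ,
        show 2 * ((a + 1) / 2) + 1 = a + 1 by omega]

theorem mul_rpow_mul_rpow_le {x y α α' β β' : ℝ} (hx0 : 0 < x) (hx1 : x ≤ 1) (hy : 1 ≤ y)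
    (hα : α' ≤ α) (hβ : β ≤ β') : x ^ α * y ^ β ≤ x ^ α' * y ^ β' :=
  mul_le_mul (Real.rpow_le_rpow_of_exponent_ge hx0 hx1 hα)
    (Real.rpow_le_rpow_of_exponent_le hy hβ) (by positivity) (by positivity)

/-! ### The weights of the Hamiltonian as functions of λ -/

section lam

variable {N : ℕ}

theorem natCast_sub_one_pos (hN : 2 ≤ N) : (0 : ℝ) < (N : ℝ) - 1 := by
  have : (2 : ℝ) ≤ N := by exact_mod_cast hN
  linarith

theorem lam_pos (hN : 2 ≤ N) : 0 < lam N := one_div_pos.2 (natCast_sub_one_pos hN)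

theorem lam_le_one (hN : 2 ≤ N) : lam N ≤ 1 := by
  have : (2 : ℝ) ≤ N := by exact_mod_cast hN
  rw [lam, div_le_one (natCast_sub_one_pos hN)]
  linarith

theorem lam_rpow_even (j : ℕ) : lam N ^ (((2 * j : ℕ) : ℝ) / 2) = lam N ^ j := by
  rw [← Real.rpow_natCast]
  congr 1
  push_cast
  ring

theorem lam_rpow_odd (hN : 2 ≤ N) (j : ℕ) :
    lam N ^ (((2 * j + 1 : ℕ) : ℝ) / 2) = Real.sqrt (lam N) * lam N ^ j := by
  rw [Real.sqrt_eq_rpow, ← Real.rpow_natCast, ← Real.rpow_add (lam_pos hN)]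
  congr 1
  push_cast
  ring

theorem excitationWeights_one (hN : 2 ≤ N) (k : ℕ) :
    (excitationWeights N).1.1 k = 1 - lam N * ((k : ℝ) - 1) := by
  have h := (natCast_sub_one_pos hN).ne'
  simp only [excitationWeights, lam]
  field_simp
  ring

theorem excitationWeights_two (hN : 2 ≤ N) (k : ℕ) :
    (excitationWeights N).1.2 k =
      Real.sqrt (max ((1 - lam N * ((k : ℝ) - 1)) * (1 - lam N * k)) 0) := by
  have h := natCast_sub_one_pos hN
  have e : ((N : ℝ) - k) * ((N : ℝ) - k - 1) =
      ((N : ℝ) - 1) ^ 2 * ((1 - lam N * ((k : ℝ) - 1)) * (1 - lam N * k)) := by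
    rw [lam]
    field_simp
    ring
  have e2 : max (((N : ℝ) - k) * ((N : ℝ) - k - 1)) 0 =
      ((N : ℝ) - 1) ^ 2 * max ((1 - lam N * ((k : ℝ) - 1)) * (1 - lam N * k)) 0 := by
    rw [mul_max_of_nonneg _ _ (by positivity), mul_zero, e]
  simp only [excitationWeights]
  rw [e2, Real.sqrt_mul (by positivity), Real.sqrt_sq h.le]
  field_simp

theorem excitationWeights_three (hN : 2 ≤ N) (k : ℕ) :
    (excitationWeights N).2.1 k =
      Real.sqrt (lam N) * Real.sqrt (max (1 - lam N * ((k : ℝ) - 1)) 0) := by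
  have h := natCast_sub_one_pos hN
  -- Only one factor N - k stands under this root, so dividing by N - 1 leaves an extra √λ, the
  -- source of the half-integer powers.
  have e2 : max ((N : ℝ) - k) 0 = ((N : ℝ) - 1) ^ 2 *
      (lam N * max (1 - lam N * ((k : ℝ) - 1)) 0) := by
    rw [mul_max_of_nonneg _ _ (lam_pos hN).le, mul_max_of_nonneg _ _ (by positivity), mul_zero,
      mul_zero]
    congr 1
    rw [lam]
    field_simp
    ring
  simp only [excitationWeights]
  rw [e2, Real.sqrt_mul (by positivity), Real.sqrt_sq h.le, Real.sqrt_mul (lam_pos hN).le]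
  field_simp

end lam

/-- The difference between the coefficients of the excitation Hamiltonian and of its expansion. -/
def remainderWeights (N a : ℕ) : ((ℕ → ℝ) × (ℕ → ℝ)) × ((ℕ → ℝ) × ℝ) :=
  excitationWeights N - ∑ n ∈ Finset.range (a + 1), lam N ^ ((n : ℝ) / 2) • coeffWeights n

theorem natCast_le_two_mul_div_two (a : ℕ) : (a : ℝ) ≤ 2 * ((a / 2 : ℕ) : ℝ) + 1 := by
  have h : a ≤ 2 * (a / 2) + 1 := by omega
  exact_mod_cast h

/-- The weight 1 - λ(k-1) is reproduced exactly once a ≥ 2; for a ≤ 1 the linear term is left over,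
and λ ≤ λ^((a+1)/2). -/
theorem remainderWeights_one_bound {N : ℕ} (hN : 2 ≤ N) (a k : ℕ) :
    |(remainderWeights N a).1.1 k| ≤
      lam N ^ (((a : ℝ) + 1) / 2) * ((k : ℝ) + 1) ^ (((a : ℝ) + 4) / 2 - 1) := by
  have hl := lam_pos hN
  have e : (remainderWeights N a).1.1 k =
      if 2 ≤ a then 0 else -(lam N * ((k : ℝ) - 1)) := by
    simp only [remainderWeights, Prod.fst_sub, Prod.fst_sum, Prod.smul_fst, Pi.sub_apply,
      Finset.sum_apply, Pi.smul_apply, smul_eq_mul, excitationWeights_one hN, coeffWeights,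
      mul_add, Finset.sum_add_distrib, mul_ite, mul_zero, mul_one, Finset.sum_ite_eq',
      Finset.mem_range]
    rw [if_pos (by omega)]
    by_cases h : 2 ≤ a
    · rw [if_pos (by omega), if_pos h]
      simp
      ring
    · rw [if_neg (by omega), if_neg h]
      simp
  rw [e]
  split_ifs with h
  · rw [abs_zero]
    positivity
  · rw [abs_neg, abs_mul, abs_of_pos hl]
    have ha : (a : ℝ) ≤ 1 := by exact_mod_cast (by omega : a ≤ 1)
    have ha0 : (0 : ℝ) ≤ a := a.cast_nonneg
    have h1 := mul_rpow_mul_rpow_le (α := 1) (α' := ((a : ℝ) + 1) / 2) (β := 1)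
      (β' := ((a : ℝ) + 4) / 2 - 1) hl (lam_le_one hN) (one_le_natCast_add_one k)
      (by linarith) (by linarith)
    rw [Real.rpow_one, Real.rpow_one] at h1
    exact (mul_le_mul_of_nonneg_left (abs_sub_one_le k) hl.le).trans h1

/-- The Taylor order ⌊a/2⌋ + 1 lies between (a+1)/2, as needed for λ, and (a+4)/2 - 1, as allowed
for k + 1. -/
theorem exists_remainderWeights_two_bound (a : ℕ) :
    ∃ C : ℝ, 0 ≤ C ∧ ∀ N : ℕ, 2 ≤ N → ∀ k : ℕ, |(remainderWeights N a).1.2 k| ≤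
      C * (lam N ^ (((a : ℝ) + 1) / 2) * ((k : ℝ) + 1) ^ (((a : ℝ) + 4) / 2 - 1)) := by
  obtain ⟨C, hC, h⟩ := exists_remainder_two_bound (a / 2)
  refine ⟨C, hC, fun N hN k => ?_⟩
  have hl := lam_pos hN
  have e : (remainderWeights N a).1.2 k =
      Real.sqrt (max ((1 - lam N * ((k : ℝ) - 1)) * (1 - lam N * k)) 0) -
        ∑ n ∈ Finset.range (a / 2 + 1), lam N ^ n * polyTwo n k := by
    simp only [remainderWeights, Prod.fst_sub, Prod.fst_sum, Prod.smul_fst, Prod.snd_sub,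
      Prod.snd_sum, Prod.smul_snd, Pi.sub_apply, Finset.sum_apply, Pi.smul_apply, smul_eq_mul,
      excitationWeights_two hN, coeffWeights, mul_ite, mul_zero]
    rw [sum_range_even (fun n => lam N ^ ((n : ℝ) / 2) * polyTwo (n / 2) k)]
    congr 1
    refine Finset.sum_congr rfl fun j _ => ?_
    rw [lam_rpow_even, Nat.mul_div_cancel_left j (by norm_num)]
  rw [e]
  refine (h _ k hl.le).trans (mul_le_mul_of_nonneg_left ?_ hC)
  rw [mul_pow, ← Real.rpow_natCast, ← Real.rpow_natCast]
  have h1 := natCast_le_two_mul_div_two a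
  have h2 := cast_div_two_le a
  exact mul_rpow_mul_rpow_le hl (lam_le_one hN) (one_le_natCast_add_one k)
    (by push_cast at h1 h2 ⊢; linarith) (by push_cast at h1 h2 ⊢; linarith)

/-- The Taylor order is ⌊(a+1)/2⌋ ≤ (a+4)/2 - 3/2, and the prefactor √λ raises the power of λ to at
least (a+1)/2. For a = 0 the Taylor sum is empty. -/
theorem exists_remainderWeights_three_bound (a : ℕ) :
    ∃ C : ℝ, 0 ≤ C ∧ ∀ N : ℕ, 2 ≤ N → ∀ k : ℕ, |(remainderWeights N a).2.1 k| ≤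
      C * (lam N ^ (((a : ℝ) + 1) / 2) * ((k : ℝ) + 1) ^ (((a : ℝ) + 4) / 2 - 3 / 2)) := by
  obtain ⟨C, hC, h⟩ := exists_remainder_one_bound ((a + 1) / 2)
  refine ⟨C, hC, fun N hN k => ?_⟩
  have hl := lam_pos hN
  have e : (remainderWeights N a).2.1 k = Real.sqrt (lam N) *
      (Real.sqrt (max (1 - lam N * ((k : ℝ) - 1)) 0) -
        ∑ n ∈ Finset.range ((a + 1) / 2), lam N ^ n * (coeffC 0 n * ((k : ℝ) - 1) ^ n)) := by
    simp only [remainderWeights, Prod.fst_sub, Prod.fst_sum, Prod.smul_fst, Prod.snd_sub,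
      Prod.snd_sum, Prod.smul_snd, Pi.sub_apply, Finset.sum_apply, Pi.smul_apply, smul_eq_mul,
      excitationWeights_three hN, coeffWeights, mul_ite, mul_zero]
    rw [sum_range_odd (fun n => lam N ^ ((n : ℝ) / 2) *
      (coeffC 0 (n / 2) * ((k : ℝ) - 1) ^ (n / 2))), mul_sub (Real.sqrt (lam N)), Finset.mul_sum]
    congr 1
    refine Finset.sum_congr rfl fun j _ => ?_
    rw [lam_rpow_odd hN, show (2 * j + 1) / 2 = j by omega]
    ring
  rw [e, abs_mul, abs_of_nonneg (Real.sqrt_nonneg _)]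
  refine (mul_le_mul_of_nonneg_left (h _ k hl.le (lam_le_one hN)) (Real.sqrt_nonneg _)).trans ?_
  rw [mul_left_comm]
  refine mul_le_mul_of_nonneg_left ?_ hC
  rw [mul_pow, ← mul_assoc, Real.sqrt_eq_rpow, ← Real.rpow_natCast, ← Real.rpow_natCast,
    ← Real.rpow_add hl]
  have h1 : (a : ℝ) ≤ 2 * (((a + 1) / 2 : ℕ) : ℝ) := by
    exact_mod_cast (by omega : a ≤ 2 * ((a + 1) / 2))
  have h2 : 2 * (((a + 1) / 2 : ℕ) : ℝ) ≤ a + 1 := by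
    exact_mod_cast (by omega : 2 * ((a + 1) / 2) ≤ a + 1)
  exact mul_rpow_mul_rpow_le hl (lam_le_one hN) (one_le_natCast_add_one k)
    (by linarith) (by linarith)

theorem abs_remainderWeights_four_le {N : ℕ} (hN : 2 ≤ N) (a : ℕ) :
    |(remainderWeights N a).2.2| ≤ lam N ^ (((a : ℝ) + 1) / 2) := by
  have hl := lam_pos hN
  have e : (remainderWeights N a).2.2 = if 2 ≤ a then 0 else lam N := by
    simp only [remainderWeights, Prod.snd_sub, Prod.snd_sum, Prod.smul_snd, smul_eq_mul,
      excitationWeights, coeffWeights, mul_ite, mul_zero, mul_one, Finset.sum_ite_eq',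
      Finset.mem_range]
    by_cases h : 2 ≤ a
    · rw [if_pos (by omega), if_pos h]
      simp [lam]
    · rw [if_neg (by omega), if_neg h, sub_zero, lam]
  rw [e]
  split_ifs with h
  · rw [abs_zero]
    positivity
  · have ha : (a : ℝ) ≤ 1 := by exact_mod_cast (by omega : a ≤ 1)
    rw [abs_of_pos hl]
    calc lam N = lam N ^ (1 : ℝ) := (Real.rpow_one _).symm
      _ ≤ _ := Real.rpow_le_rpow_of_exponent_ge hl (lam_le_one hN) (by linarith)

variable {d : ℕ}

/-- The remainder `ℛ^(a)`, sector by sector. -/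
def remainder (v : Pos d → ℝ) (φ : OneBody d) (N a : ℕ) : SeqOp d :=
  assembled v φ ((lam N ^ (((a : ℝ) + 1) / 2))⁻¹ • remainderWeights N a)

theorem exists_relBdd_remainder (a : ℕ) {v : Pos d → ℝ} {M : ℝ} (hv : ∀ x, |v x| ≤ M)
    (hM : 0 ≤ M) : ∃ C : ℝ, 0 < C ∧ ∀ φ : OneBody d, ‖φ‖ = 1 → ∀ N : ℕ, 2 ≤ N →
      RelBdd (remainder v φ N a) (((a : ℝ) + 4) / 2) C := by
  obtain ⟨C₂, hC₂, h₂⟩ := exists_remainderWeights_two_bound a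
  obtain ⟨C₃, hC₃, h₃⟩ := exists_remainderWeights_three_bound a
  -- The constant is fixed before φ and N. The final summand 1 keeps it positive when M = 0.
  refine ⟨5 * (9 * (64 * M)) * (1 + C₂ + C₃) + 1, by positivity, fun φ hφ N hN => ?_⟩
  have ha0 : (0 : ℝ) ≤ a := a.cast_nonneg
  have hL : 0 < lam N ^ (((a : ℝ) + 1) / 2) := Real.rpow_pos_of_pos (lam_pos hN) _
  set L := lam N ^ (((a : ℝ) + 1) / 2) with hLdef
  have key : ∀ w y D : ℝ, 0 ≤ y → D ≤ 1 + C₂ + C₃ → |w| ≤ D * (L * y) →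
      |L⁻¹ * w| ≤ (1 + C₂ + C₃) * y := by
    intro w y D hy hD hw
    rw [abs_mul, abs_of_pos (inv_pos.2 hL), inv_mul_le_iff₀ hL]
    refine hw.trans ?_
    calc D * (L * y) ≤ (1 + C₂ + C₃) * (L * y) := mul_le_mul_of_nonneg_right hD (by positivity)
      _ = _ := by ring
  refine (relBdd_assembled hv hM hφ (by positivity : 0 ≤ 1 + C₂ + C₃) (by linarith)
    (fun k => ?_) (fun k => ?_) (fun k => ?_) ?_).mono (by linarith)
  · exact key _ _ 1 (by positivity) (by linarith)
      (by rw [one_mul]; exact remainderWeights_one_bound hN a k)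
  · exact key _ _ C₂ (by positivity) (by linarith) (h₂ N hN k)
  · exact key _ _ C₃ (by positivity) (by linarith) (h₃ N hN k)
  · have h := key (remainderWeights N a).2.2 1 1 zero_le_one (by linarith)
      (by rw [one_mul, mul_one]; exact abs_remainderWeights_four_le hN a)
    rwa [mul_one] at h

/-! ### The operator identity and its domain -/

variable {v : Pos d → ℝ} {φ : OneBody d} {N : ℕ}

theorem sum_add_smul_remainder (hN : 2 ≤ N) (a : ℕ) :
    (∑ n ∈ Finset.range (a + 1), ((lam N ^ ((n : ℝ) / 2) : ℝ) : ℂ) • coeffRest v φ n)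
      + ((lam N ^ (((a : ℝ) + 1) / 2) : ℝ) : ℂ) • remainder v φ N a = excitationRest v φ N := by
  have hL : lam N ^ (((a : ℝ) + 1) / 2) ≠ 0 := (Real.rpow_pos_of_pos (lam_pos hN) _).ne'
  rw [remainder, ← assembled_smul, smul_inv_smul₀ hL, excitationRest_eq_assembled]
  simp only [coeffRest_eq_assembled, ← assembled_smul]
  rw [← assembled_sum, ← assembled_add, remainderWeights, add_sub_cancel]

theorem linearPMap_add_le_add {E F : Type*} [AddCommGroup E] [Module ℂ E] [AddCommGroup F]
    [Module ℂ F] {f f' g g' : E →ₗ.[ℂ] F} (hf : f ≤ f') (hg : g ≤ g') : f + g ≤ f' + g' := by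
  refine ⟨fun x hx => ⟨hf.1 hx.1, hg.1 hx.2⟩, ?_⟩
  rintro ⟨x, hx⟩ ⟨y, hy⟩ h
  obtain rfl : x = y := h
  rw [LinearPMap.add_apply, LinearPMap.add_apply]
  exact congrArg₂ (· + ·) (hf.2 rfl) (hg.2 rfl)

/-- `opK0` is given by its graph and not as a `SeqOp`, so it stays outside while the other terms are
merged; c 0 = 1 leaves it unscaled. -/
theorem sum_coeffHamiltonian_le (c : ℕ → ℂ) (hc : c 0 = 1) (a : ℕ) :
    ∑ n ∈ Finset.range (a + 1), c n • coeffHamiltonian v φ n ≤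
      opK0 v φ + (∑ n ∈ Finset.range (a + 1), c n • coeffRest v φ n).toFock := by
  induction a with
  | zero =>
    rw [Finset.sum_range_one, Finset.sum_range_one, hc, one_smul, one_smul, coeffHamiltonian,
      if_pos rfl]
  | succ a ih =>
    rw [Finset.sum_range_succ, Finset.sum_range_succ _ (a + 1)]
    have h1 : c (a + 1) • coeffHamiltonian v φ (a + 1) ≤
        (c (a + 1) • coeffRest v φ (a + 1)).toFock := by
      rw [coeffHamiltonian, if_neg (Nat.succ_ne_zero a)]
      exact smul_toFock_le _ _
    refine (linearPMap_add_le_add ih h1).trans ?_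
    rw [add_assoc]
    exact linearPMap_add_le_add le_rfl (toFock_add_le _ _)

theorem expansion_le (hN : 2 ≤ N) (a : ℕ) :
    expansion v φ N a (remainder v φ N a).toFock ≤ excitationHamiltonian v φ N := by
  have h := sum_coeffHamiltonian_le (v := v) (φ := φ)
    (fun n => ((lam N ^ ((n : ℝ) / 2) : ℝ) : ℂ)) (by simp) a
  refine (linearPMap_add_le_add h (smul_toFock_le _ _)).trans ?_
  rw [add_assoc, excitationHamiltonian, ← sum_add_smul_remainder hN a]
  exact linearPMap_add_le_add le_rfl (toFock_add_le _ _)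

theorem le_sum_coeffHamiltonian_domain (c : ℕ → ℂ) (a : ℕ) (S : Submodule ℂ (Fock d))
    (hS0 : S ≤ (opK0 v φ).domain) (hS : ∀ n ≤ a, S ≤ (coeffRest v φ n).toFock.domain) :
    S ≤ (∑ n ∈ Finset.range (a + 1), c n • coeffHamiltonian v φ n).domain := by
  have key : ∀ n ≤ a, S ≤ (coeffHamiltonian v φ n).domain := by
    intro n hn
    rw [coeffHamiltonian]
    split_ifs with h0
    · subst h0
      exact le_inf hS0 (hS 0 hn)
    · exact hS n hn
  have : ∀ b ≤ a + 1, S ≤ (∑ n ∈ Finset.range b, c n • coeffHamiltonian v φ n).domain := by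
    intro b
    induction b with
    -- The empty sum is the zero operator, with full domain.
    | zero => exact fun _ => le_top
    | succ b ih =>
      intro hb
      rw [Finset.sum_range_succ]
      exact le_inf (ih (by omega)) (key b (by omega))
  exact this _ le_rfl

theorem RelBdd.domain_le {A : SeqOp d} {s C : ℝ} (h : RelBdd A s C) :
    (numPow d s).domain ≤ A.toFock.domain :=
  fun ϕ hϕ => (h ⟨ϕ, hϕ⟩).1

end BoseGas

end

/-- `A ≤ B` for partially defined operators means that `B` extends `A`. -/
theorem lemma3p1 (d : ℕ) (hd : 1 ≤ d) (v : BoseGas.Pos d → ℝ) (hv_meas : Measurable v)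
    (hv_bdd : ∃ M : ℝ, ∀ x, |v x| ≤ M) (hv_even : ∀ x, v (-x) = v x) (a : ℕ) :
    ∃ C : ℝ, 0 < C ∧
      ∀ φ : BoseGas.OneBody d, ‖φ‖ = 1 → ∀ N : ℕ, 2 ≤ N →
        ∃ R : BoseGas.Fock d →ₗ.[ℂ] BoseGas.Fock d,
          BoseGas.expansion v φ N a R ≤ BoseGas.excitationHamiltonian v φ N ∧
          (BoseGas.opK0 v φ).domain ⊓ (BoseGas.numPow d (((a : ℝ) + 4) / 2)).domain ≤
            (BoseGas.expansion v φ N a R).domain ∧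
          ∀ ϕ : (BoseGas.numPow d (((a : ℝ) + 4) / 2)).domain,
            ∃ h : (ϕ : BoseGas.Fock d) ∈ R.domain,
              ‖R ⟨ϕ, h⟩‖ ≤ C * ‖BoseGas.numPow d (((a : ℝ) + 4) / 2) ϕ‖ := by
  obtain ⟨M, hM⟩ := hv_bdd
  have hM0 : 0 ≤ M := (abs_nonneg _).trans (hM 0)
  obtain ⟨C, hC, h⟩ := BoseGas.exists_relBdd_remainder a hM hM0
  refine ⟨C, hC, fun φ hφ N hN => ⟨(BoseGas.remainder v φ N a).toFock,
    BoseGas.expansion_le hN a, ?_, h φ hφ N hN⟩⟩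
  refine le_inf (BoseGas.le_sum_coeffHamiltonian_domain _ a _ inf_le_left fun n hn => ?_)
    (inf_le_right.trans (h φ hφ N hN).domain_le)
  obtain ⟨D, hD⟩ := BoseGas.relBdd_coeffRest hM hM0 hφ hn
  exact inf_le_right.trans hD.domain_le
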